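/- **Setting.** Let $\mathcal X=\mathbb R^m$ or $\mathcal X=[0,\infty)^m$, with interior $\mathcal X^\circ$. Consider an exponential family with densities $p(x\mid\theta)=\exp(\theta^\top t(x)-a(\theta)+b(x))$ with respect to Lebesgue measure on $\mathcal X$, with $t:\mathcal X\to\mathbb R^r$ and natural parameter space $\Omega=\{\theta\in\mathbb R^r:\int_{\mathcal X}\exp(\theta^\top t+b)\,dx<\infty\}$. Let $\theta_0\in\Omega$, let $h_1,\dots,h_m\ge 0$ be measurable weight functions on $\mathcal X$, and put $$\Gamma(x)=\sum_{j=1}^m h_j(x)\,\partial_jt(x)\,\partial_jt(x)^\top,\qquad g(x)=-\sum_{j=1}^m\big(h_j(x)\,\partial_jb(x)\,\partial_jt(x)+h_j(x)\,\partial_{jj}t(x)+\partial_jh_j(x)\,\partial_jt(x)\big).$$ **Assumptions.** 1. (Score matching.) $\Omega$ has non-empty interior (the family is $r$-dimensional); $t$ and $b$ are twice continuously differentiable on $\mathcal X^\circ$; each $h_j$ is positive almost everywhere on $\mathcal X$ and, as a function of $x_j$ alone along any line in $\mathcal X^\circ$, absolutely continuous on compact intervals. For all $\theta\in\Omega$ and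 all $j$: along every line in $\mathcal X^\circ$ in the direction of the $j$-th coordinate, $p(x\mid\theta_0)h_j(x)\,\partial_j\log p(x\mid\theta)$ has finite and equal limits at the two ends ($x_j\to\infty$, and $x_j\to-\infty$ respectively $x_j\searrow0$); and under $\theta_0$ the functions $h_j(\partial_j\log p(\cdot\mid\theta))^2$ and $\partial_jh_j\,\partial_j\log p(\cdot\mid\theta)+h_j\,\partial_{jj}\log p(\cdot\mid\theta)$ are integrable. 2. (A1) No $t_i$ is constant on $\mathcal X^\circ$. (A2) For each $j$ let $R_j=\{i:\partial_jt_i\not\equiv0\text{ on }\mathcal X^\circ\}$ and $v^{(j)}(x)=\sqrt{h_j(x)}\,(\partial_jt_i(x))_{i\in R_j}$; then for every proper linear subspace $L$ of $\mathbb R^{R_j}$ the set $\{x\in\mathcal X:v^{(j)}(x)\in L\}$ is a Lebesgue null set. 3. $\Gamma(x)$ and $g(x)$ have finite second moments when $x\sim p(\cdot\mid\theta_0)$. **Estimator.** A geometric median of points $\mu_1,\dots,\mu_K$ is any minimizer $z$ of $\sum_k\|\mu_k-z\|_2$ (matrices in $\mathbb R^{r\times r}$ are regarded as vectors in $\mathbb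 R^{r^2}$). A geometric median of means with $K$ blocks of $n$ points is a geometric median of the means of the $K$ consecutive blocks of size $\lfloor n/K\rfloor$ (the remaining points are discarded). For a sample of size $n$, let $\hat\Gamma_K$ and $\hat g_K$ be geometric medians of means with $K$ blocks of the values of $\Gamma$ and of $g$ at the observations. The robust score matching estimator minimizes $\tfrac12\theta^\top\hat\Gamma_K\theta-\theta^\top\hat g_K$; if $\hat\Gamma_K$ is positive definite, the unconstrained minimizer is $\hat\Gamma_K^{-1}\hat g_K$. **Claim.** There is a choice of block number $K=K(n_c)$, depending only on the number $n_c$ of corrupted samples, such that the following holds for every family and every $\theta_0$ as above. Let $x^{(1)},x^{(2)},\dots$ be i.i.d. with density $p(\cdot\mid\theta_0)$, let $n_c=n_c(n)=o(n)$, and for each $n$ let up to $n_c$ of the observations $x^{(1)},\dots,x^{(n)}$ be replaced arbitrarily (the choice of the replaced observations and their new values may depend on the whole sample). Then, for the estimators computed from the corrupted samples with $K=K(n_c)$ blocks, as $n\to\infty$: - $1\le K(n_c)\le n$ for all large $n$, and $\hat\Gamma_{K}$ is positive definite with probability tending to one; - $\hat\Gamma_{K}^{-1}\hat g_{K}\to\theta_0$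 in probability; - minimizers of $\tfrac12\theta^\top\hat\Gamma_{K}\theta-\theta^\top\hat g_{K}$ over $\theta\in\Omega$ are consistent: for every $\varepsilon>0$, the probability that there is such a minimizer at distance at least $\varepsilon$ from $\theta_0$ tends to zero; if $\theta_0$ is an interior point of $\Omega$, then with probability tending to one there is exactly one such minimizer, namely $\hat\Gamma_{K}^{-1}\hat g_{K}$. (Probabilities of possibly non-measurable events are understood as outer probabilities; a claim that the probability of an event tends to one means that the outer probability of its complement tends to zero.) -/

import Mathlib

open MeasureTheory ProbabilityTheory Filter Topology Asymptotics

noncomputable section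

namespace RobustSM

/-! ### Geometric median of means -/

/-- `z` is a geometric median of the points `p k`: it minimises the sum of the distances. -/
def IsGeometricMedian {V : Type*} [NormedAddCommGroup V] {K : ℕ} (p : Fin K → V) (z : V) : Prop :=
  ∀ z' : V, ∑ k, ‖p k - z‖ ≤ ∑ k, ‖p k - z'‖

/-- The `k`-th of `K` block means of `v 0, …, v (n - 1)`. The blocks are consecutive and have the
common size `⌊n / K⌋`; if `K` does not divide `n`, the last `n - K ⌊n / K⌋` points are unused. -/
def blockMean {V : Type*} [AddCommGroup V] [Module ℝ V] {n : ℕ} (K : ℕ) (v : Fin n → V)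
    (k : Fin K) : V :=
  ((n / K : ℕ) : ℝ)⁻¹ •
    ∑ i : Fin n with k.val * (n / K) ≤ i.val ∧ i.val < (k.val + 1) * (n / K), v i

/-- `z` is a geometric median of means of `v 0, …, v (n - 1)` with `K` blocks. -/
def IsGMoM {V : Type*} [NormedAddCommGroup V] [Module ℝ V] {n : ℕ} (K : ℕ) (v : Fin n → V)
    (z : V) : Prop :=
  IsGeometricMedian (blockMean K v) z

/-- An `r × r` matrix as a vector of the Euclidean space of dimension `r²`. -/
def vecMatrix {r : ℕ} (A : Matrix (Fin r) (Fin r) ℝ) : EuclideanSpace ℝ (Fin r × Fin r) :=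
  WithLp.toLp 2 (fun q => A q.1 q.2)

/-! ### Sample spaces and partial derivatives -/

/-- The two kinds of sample spaces: `ℝ^m` and `[0, ∞)^m`. -/
inductive SampleSpace : Type
  | whole
  | nonneg

/-- The sample space `ℝ^m` or `[0, ∞)^m`. -/
def SampleSpace.carrier (D : SampleSpace) (m : ℕ) : Set (EuclideanSpace ℝ (Fin m)) :=
  match D with
  | .whole => Set.univ
  | .nonneg => {x | ∀ j, 0 ≤ x j}

/-- One coordinate of the interior of the sample space: `ℝ` or `(0, ∞)`. -/
def SampleSpace.openAxis (D : SampleSpace) : Set ℝ :=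
  match D with
  | .whole => Set.univ
  | .nonneg => Set.Ioi 0

/-- The interior `ℝ^m` or `(0, ∞)^m` of the sample space. -/
def SampleSpace.openCarrier (D : SampleSpace) (m : ℕ) : Set (EuclideanSpace ℝ (Fin m)) :=
  {x | ∀ j, x j ∈ D.openAxis}

/-- The filter of a coordinate tending to its lower end: `s → -∞` or `s ↘ 0`. -/
def SampleSpace.lowerEnd (D : SampleSpace) : Filter ℝ :=
  match D with
  | .whole => atBot
  | .nonneg => 𝓝[>] 0

/-- The `j`-th partial derivative `∂_j f (x)`. -/
def pd {m : ℕ} {F : Type*} [NormedAddCommGroup F] [NormedSpace ℝ F] (j : Fin m)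
    (f : EuclideanSpace ℝ (Fin m) → F) (x : EuclideanSpace ℝ (Fin m)) : F :=
  lineDeriv ℝ f x (EuclideanSpace.single j (1 : ℝ))

/-- The point `x` with its `j`-th coordinate replaced by `s`. -/
def setCoord {m : ℕ} (j : Fin m) (x : EuclideanSpace ℝ (Fin m)) (s : ℝ) :
    EuclideanSpace ℝ (Fin m) :=
  WithLp.toLp 2 (Function.update x.ofLp j s)

/-! ### Exponential families and score matching -/

/-- The data of an exponential family on `ℝ^m` or `[0, ∞)^m` with `r` natural parameters, i.e. of
the densities `exp (θᵀ t(x) - a(θ) + b(x))`, together with the weights `h` of score matching. -/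
structure ExpFamily (m r : ℕ) where
  /-- the sample space -/
  space : SampleSpace
  /-- the sufficient statistic -/
  t : EuclideanSpace ℝ (Fin m) → EuclideanSpace ℝ (Fin r)
  /-- the log base density -/
  b : EuclideanSpace ℝ (Fin m) → ℝ
  /-- the weight functions `h 1, …, h m` -/
  h : Fin m → EuclideanSpace ℝ (Fin m) → ℝ

namespace ExpFamily

variable {m r : ℕ} (M : ExpFamily m r)

/-- The sample space of the family. -/
def X : Set (EuclideanSpace ℝ (Fin m)) := M.space.carrier m

/-- The interior of the sample space. -/
def openX : Set (EuclideanSpace ℝ (Fin m)) := M.space.openCarrier m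

/-- The natural parameter space: all `θ` for which `∫ exp (θᵀ t + b)` is finite. -/
def naturalSpace : Set (EuclideanSpace ℝ (Fin r)) :=
  {θ | IntegrableOn (fun x => Real.exp (inner ℝ θ (M.t x) + M.b x)) M.X}

/-- The log normalising constant `a(θ)`. -/
def a (θ : EuclideanSpace ℝ (Fin r)) : ℝ :=
  Real.log (∫ x in M.X, Real.exp (inner ℝ θ (M.t x) + M.b x))

/-- The log density `log p(x | θ) = θᵀ t(x) - a(θ) + b(x)`. -/
def logDensity (θ : EuclideanSpace ℝ (Fin r)) (x : EuclideanSpace ℝ (Fin m)) : ℝ :=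
  inner ℝ θ (M.t x) - M.a θ + M.b x

/-- The density `p(x | θ)`. -/
def density (θ : EuclideanSpace ℝ (Fin r)) (x : EuclideanSpace ℝ (Fin m)) : ℝ :=
  Real.exp (M.logDensity θ x)

/-- The distribution `P_θ` with density `p(· | θ)` with respect to Lebesgue measure on the sample
space. -/
def law (θ : EuclideanSpace ℝ (Fin r)) : Measure (EuclideanSpace ℝ (Fin m)) :=
  (volume.restrict M.X).withDensity (fun x => ENNReal.ofReal (M.density θ x))

/-- `Γ(x) = ∑ j, h_j(x) ∂_j t(x) ∂_j t(x)ᵀ`. -/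
def Gam (x : EuclideanSpace ℝ (Fin m)) : Matrix (Fin r) (Fin r) ℝ :=
  ∑ j, M.h j x • Matrix.vecMulVec (pd j M.t x).ofLp (pd j M.t x).ofLp

/-- `g(x) = - ∑ j, (h_j(x) ∂_j b(x) ∂_j t(x) + h_j(x) ∂_jj t(x) + ∂_j h_j(x) ∂_j t(x))`. -/
def gvec (x : EuclideanSpace ℝ (Fin m)) : EuclideanSpace ℝ (Fin r) :=
  -∑ j, ((M.h j x * pd j M.b x) • pd j M.t x + M.h j x • pd j (pd j M.t) x
    + pd j (M.h j) x • pd j M.t x)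

/-- The conditions under which generalized score matching identifies the true parameter `θ₀`. -/
structure ScoreMatchingRegular (θ₀ : EuclideanSpace ℝ (Fin r)) : Prop where
  /-- the true distribution belongs to the family -/
  mem : θ₀ ∈ M.naturalSpace
  /-- the family is `r`-dimensional -/
  full : (interior M.naturalSpace).Nonempty
  /-- the densities are twice continuously differentiable -/
  t_smooth : ContDiffOn ℝ 2 M.t M.openX
  b_smooth : ContDiffOn ℝ 2 M.b M.openX
  /-- the weights are measurable, non-negative, positive almost everywhere and, in the respective
  coordinate, locally absolutely continuous -/
  h_meas : ∀ j, Measurable (M.h j)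
  h_nonneg : ∀ j, ∀ x ∈ M.X, 0 ≤ M.h j x
  h_pos : ∀ j, ∀ᵐ x ∂(volume.restrict M.X), 0 < M.h j x
  h_absCont : ∀ j, ∀ x ∈ M.openX, ∀ c ∈ M.space.openAxis, ∀ d ∈ M.space.openAxis,
    AbsolutelyContinuousOnInterval (fun s => M.h j (setCoord j x s)) c d
  /-- `p(x | θ₀) h_j(x) ∂_j log p(x | θ)` has equal limits at the two ends of each line in the
  `j`-th coordinate direction -/
  boundary : ∀ θ ∈ M.naturalSpace, ∀ j, ∀ x ∈ M.openX, ∃ ℓ : ℝ,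
    Tendsto (fun s => M.density θ₀ (setCoord j x s) * M.h j (setCoord j x s) *
      pd j (M.logDensity θ) (setCoord j x s)) atTop (𝓝 ℓ) ∧
    Tendsto (fun s => M.density θ₀ (setCoord j x s) * M.h j (setCoord j x s) *
      pd j (M.logDensity θ) (setCoord j x s)) M.space.lowerEnd (𝓝 ℓ)
  /-- `E ‖∇ log p(x | θ) ∘ h(x)^{1/2}‖₂² < ∞` under `θ₀` -/
  score_sq : ∀ θ ∈ M.naturalSpace, ∀ j,
    Integrable (fun x => M.h j x * (pd j (M.logDensity θ) x) ^ 2) (M.law θ₀)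
  /-- `E ∑ j, |∂_j (h_j(x) ∂_j log p(x | θ))| < ∞` under `θ₀` -/
  score_deriv : ∀ θ ∈ M.naturalSpace, ∀ j,
    Integrable (fun x => pd j (M.h j) x * pd j (M.logDensity θ) x
      + M.h j x * pd j (pd j (M.logDensity θ)) x) (M.law θ₀)

/-- No component of the sufficient statistic is constant. -/
def NonconstantStatistic : Prop :=
  ∀ i : Fin r, ∃ x ∈ M.openX, ∃ y ∈ M.openX, M.t x i ≠ M.t y i

/-- `R_j`, the set of all `i` such that `∂_j t_i` is not identically zero. -/
def R (j : Fin m) : Set (Fin r) := {i | ∃ x ∈ M.openX, pd j M.t x i ≠ 0}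

/-- `v^{(j)}(x)`, the vector `√(h_j(x)) ∂_j t(x)` restricted to the components in `R_j`. -/
def v (j : Fin m) (x : EuclideanSpace ℝ (Fin m)) : M.R j → ℝ :=
  fun i => Real.sqrt (M.h j x) * pd j M.t x i.1

/-- Preimages of proper linear subspaces under every `v^{(j)}` are Lebesgue null sets. -/
def NullPreimages : Prop :=
  ∀ j, ∀ L : Submodule ℝ (M.R j → ℝ), L ≠ ⊤ → volume {x ∈ M.X | M.v j x ∈ L} = 0

/-- `Γ(x)` and `g(x)` have finite second moments under `P_θ₀`. -/
def SecondMoments (θ₀ : EuclideanSpace ℝ (Fin r)) : Prop :=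
  MemLp (fun x => vecMatrix (M.Gam x)) 2 (M.law θ₀) ∧ MemLp M.gvec 2 (M.law θ₀)

end ExpFamily

/-- The quadratic loss `½ θᵀ G θ - θᵀ g`. -/
def quadLoss {r : ℕ} (G : Matrix (Fin r) (Fin r) ℝ) (g θ : EuclideanSpace ℝ (Fin r)) : ℝ :=
  1 / 2 * (θ.ofLp ⬝ᵥ G.mulVec θ.ofLp) - θ.ofLp ⬝ᵥ g.ofLp

/-- `θ` minimises the quadratic loss over the parameter set `S`. -/
def IsLossMin {r : ℕ} (S : Set (EuclideanSpace ℝ (Fin r))) (G : Matrix (Fin r) (Fin r) ℝ)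
    (g θ : EuclideanSpace ℝ (Fin r)) : Prop :=
  θ ∈ S ∧ ∀ θ' ∈ S, quadLoss G g θ ≤ quadLoss G g θ'

/-- The vector `G⁻¹ g`. -/
def invMul {r : ℕ} (G : Matrix (Fin r) (Fin r) ℝ) (g : EuclideanSpace ℝ (Fin r)) :
    EuclideanSpace ℝ (Fin r) :=
  WithLp.toLp 2 (G⁻¹.mulVec g.ofLp)

end RobustSM

end

/-! Under the true law, integration by parts gives the linear equation E[Γ] θ₀ = E[g], and E[Γ] is
positive definite. So θ₀ is the unique minimizer of the population loss, and it suffices that Γ̂ and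
ĝ are consistent for E[Γ] and E[g].

Robustness: with K = 4c + 1 blocks, c corrupted observations touch at most c < K/4 blocks. Since c =
o(n), the block size tends to infinity, so by the law of large numbers a single clean block mean
deviates with vanishing probability, and by Markov's inequality at least K/8 of them deviate with
vanishing probability. Otherwise more than 5/8 of the block means are near the expectation, which
forces the geometric median to be near it (`IsGeometricMedian.norm_sub_le`,
`tendstoInMeasure_of_isGMoM`).

Identification: uᵀ(Γ θ₀ - g) is pointwise a sum of divergence terms, each the normalized j-th
derivative of the flux p h_j uᵀ∂_j t. Equal limits of the flux at the two ends of every line make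
their means vanish (`integral_divergence`). Definiteness follows from (A1) and (A2) (`meanGam_pos`).

Perturbation: any parameter whose empirical loss is at most that of θ₀ lies within a multiple of the
coefficient error of θ₀ (`norm_sub_le_of_quadLoss_le`). This covers constrained and unconstrained
minimizers at once. Everything is deterministic once both medians are accurate, so no measurability
of the medians is needed. -/

noncomputable section

namespace RobustSM

/-! ### Geometric medians -/

/-- A geometric median is close to any point that is close to more than `5/8` of the points. -/
theorem IsGeometricMedian.norm_sub_le {V : Type*} [NormedAddCommGroup V] {K : ℕ} {p : Fin K → V}
    {z c : V} (hz : IsGeometricMedian p z) {ε : ℝ} (s : Finset (Fin K))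
    (hs : ∀ k ∉ s, ‖p k - c‖ ≤ ε) (hcard : 8 * s.card < 3 * K) : ‖z - c‖ ≤ 8 * ε := by
  have hcard' : (8 : ℝ) * s.card < 3 * K := by exact_mod_cast hcard
  have hK : (0 : ℝ) < K := by
    have : (0 : ℝ) ≤ s.card := by positivity
    linarith
  have hε : 0 ≤ ε := by
    obtain ⟨k, hk⟩ : ∃ k, k ∉ s := by
      by_contra! h
      have : s = Finset.univ := Finset.eq_univ_iff_forall.2 h
      rw [this] at hcard
      simp at hcard
      omega
    exact (norm_nonneg _).trans (hs k hk)
  -- Moving from `c` to `z` lowers a distance by at most d = ‖z - c‖, and raises it by at least d -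
  -- 2ε at a point within ε of `c`.
  have hsum : ∑ k, (if k ∈ s then -‖z - c‖ else ‖z - c‖ - 2 * ε) ≤
      ∑ k, (‖p k - z‖ - ‖p k - c‖) := by
    refine Finset.sum_le_sum fun k _ => ?_
    split_ifs with hk
    · have := norm_sub_le_norm_sub_add_norm_sub (p k) z c
      linarith
    · have h1 := hs k hk
      have h2 := norm_sub_le_norm_sub_add_norm_sub z (p k) c
      rw [norm_sub_rev z (p k)] at h2
      linarith
  have hle : ∑ k, (‖p k - z‖ - ‖p k - c‖) ≤ 0 := by
    rw [Finset.sum_sub_distrib]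
    linarith [hz c]
  rw [Finset.sum_ite, Finset.sum_const, Finset.sum_const, nsmul_eq_mul, nsmul_eq_mul,
    Finset.filter_mem_eq_inter, Finset.univ_inter, Finset.filter_not,
    Finset.filter_mem_eq_inter, Finset.univ_inter, Finset.cast_card_sdiff (Finset.subset_univ s),
    Finset.card_univ, Fintype.card_fin] at hsum
  have hd := norm_nonneg (z - c)
  have : 0 ≤ (s.card : ℝ) := by positivity
  -- The sums give (K - 2|s|) d ≤ 2 (K - |s|) ε ≤ 2Kε, and K - 2|s| > K/4; hence the factor 8.
  have h3 : (K : ℝ) * ‖z - c‖ ≤ K * (8 * ε) := by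
    nlinarith [mul_nonneg this hε, mul_nonneg (sub_nonneg.2 hcard'.le) hd]
  exact le_of_mul_le_mul_left h3 hK

/-! ### Matrices as vectors -/

theorem vecMatrix_apply {r : ℕ} (A : Matrix (Fin r) (Fin r) ℝ) (q : Fin r × Fin r) :
    vecMatrix A q = A q.1 q.2 := rfl

theorem vecMatrix_sub {r : ℕ} (A B : Matrix (Fin r) (Fin r) ℝ) :
    vecMatrix (A - B) = vecMatrix A - vecMatrix B := rfl

theorem dotProduct_mulVec_eq_inner {r : ℕ} (A : Matrix (Fin r) (Fin r) ℝ)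
    (u w : EuclideanSpace ℝ (Fin r)) :
    u.ofLp ⬝ᵥ A.mulVec w.ofLp =
      inner ℝ (vecMatrix (Matrix.vecMulVec u.ofLp w.ofLp)) (vecMatrix A) := by
  simp only [dotProduct, Matrix.mulVec, PiLp.inner_apply, vecMatrix_apply,
    Fintype.sum_prod_type, Matrix.vecMulVec_apply, Finset.mul_sum]
  refine Finset.sum_congr rfl fun i _ => Finset.sum_congr rfl fun k _ => ?_
  simp
  ring

/-- Cauchy–Schwarz for the Frobenius inner product, since u wᵀ has Frobenius norm ‖u‖‖w‖. -/
theorem abs_dotProduct_mulVec_le {r : ℕ} (A : Matrix (Fin r) (Fin r) ℝ)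
    (u w : EuclideanSpace ℝ (Fin r)) :
    |u.ofLp ⬝ᵥ A.mulVec w.ofLp| ≤ ‖vecMatrix A‖ * (‖u‖ * ‖w‖) := by
  have h : ‖vecMatrix (Matrix.vecMulVec u.ofLp w.ofLp)‖ = ‖u‖ * ‖w‖ := by
    rw [EuclideanSpace.norm_eq, EuclideanSpace.norm_eq, EuclideanSpace.norm_eq,
      ← Real.sqrt_mul (by positivity)]
    congr 1
    simp only [vecMatrix_apply, Fintype.sum_prod_type, Matrix.vecMulVec_apply,
      Finset.sum_mul_sum, norm_mul, mul_pow]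
  rw [dotProduct_mulVec_eq_inner, ← h, mul_comm]
  exact abs_real_inner_le_norm _ _

/-- The permutation of the coordinates that corresponds to transposition. -/
def transposeVec (r : ℕ) :
    EuclideanSpace ℝ (Fin r × Fin r) ≃ₗᵢ[ℝ] EuclideanSpace ℝ (Fin r × Fin r) :=
  LinearIsometryEquiv.piLpCongrLeft 2 ℝ ℝ (Equiv.prodComm _ _)

theorem transposeVec_vecMatrix {r : ℕ} (A : Matrix (Fin r) (Fin r) ℝ) :
    transposeVec r (vecMatrix A) = vecMatrix A.transpose := by
  ext q
  rfl

/-- A geometric median of points that are fixed by a linear isometry is fixed as well. -/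
theorem IsGeometricMedian.fixed {V : Type*} [NormedAddCommGroup V] [InnerProductSpace ℝ V] {K : ℕ}
    (hK : 0 < K) {p : Fin K → V} {z : V} (hz : IsGeometricMedian p z) (T : V ≃ₗᵢ[ℝ] V)
    (hp : ∀ k, T (p k) = p k) : T z = z := by
  by_contra hne
  -- Both z and T z have the same distance to each p k, so by strict convexity of the norm their
  -- midpoint is strictly closer to every point, against minimality.
  have hlt : ∀ k, ‖p k - (1 / 2 : ℝ) • (z + T z)‖ < ‖p k - z‖ := by
    intro k
    have h1 : ‖p k - T z‖ = ‖p k - z‖ := by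
      conv_lhs => rw [← hp k, ← map_sub, T.norm_map]
    have h2 := parallelogram_law_with_norm ℝ (p k - z) (p k - T z)
    have h3 : p k - z + (p k - T z) = (2 : ℝ) • (p k - (1 / 2 : ℝ) • (z + T z)) := by
      module
    have h4 : 0 < ‖p k - z - (p k - T z)‖ := by
      rw [norm_pos_iff, sub_sub_sub_cancel_left]
      exact sub_ne_zero.2 hne
    rw [h3, norm_smul, h1, Real.norm_eq_abs, abs_of_pos two_pos] at h2
    refine lt_of_pow_lt_pow_left₀ 2 (norm_nonneg _) ?_
    nlinarith
  have := Finset.sum_lt_sum_of_nonempty (s := Finset.univ) ⟨⟨0, hK⟩, Finset.mem_univ _⟩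
    fun k _ => hlt k
  exact absurd (hz _) (not_le.2 this)

/-- Valid at every point, hence also at corrupted observations, wherever they lie. -/
theorem Gam_transpose {m r : ℕ} (M : ExpFamily m r) (x : EuclideanSpace ℝ (Fin m)) :
    (M.Gam x).transpose = M.Gam x := by
  simp [ExpFamily.Gam, Matrix.transpose_sum, Matrix.transpose_vecMulVec]

/-- A geometric median of means of symmetric matrices is symmetric. -/
theorem IsGMoM.transpose_eq {r n K : ℕ} (hK : 0 < K) {v : Fin n → Matrix (Fin r) (Fin r) ℝ}
    (hv : ∀ i, (v i).transpose = v i) {G : Matrix (Fin r) (Fin r) ℝ}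
    (hG : IsGMoM K (fun i => vecMatrix (v i)) (vecMatrix G)) : G.transpose = G := by
  have h := IsGeometricMedian.fixed hK hG (transposeVec r) fun k => by
    simp only [blockMean, map_smul, map_sum, transposeVec_vecMatrix, hv]
  rw [transposeVec_vecMatrix] at h
  ext i k
  exact congrArg (fun w => w (i, k)) h

/-! ### Perturbation of quadratic losses -/

theorem abs_dotProduct_le {r : ℕ} (u w : EuclideanSpace ℝ (Fin r)) :
    |u.ofLp ⬝ᵥ w.ofLp| ≤ ‖u‖ * ‖w‖ := by
  have : u.ofLp ⬝ᵥ w.ofLp = inner ℝ w u := by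
    simp [PiLp.inner_apply, dotProduct]
  rw [this, mul_comm]
  exact abs_real_inner_le_norm _ _

/-- Second-order Taylor expansion, exact for a quadratic; symmetry makes G θ' - g the gradient at
θ'. -/
theorem quadLoss_eq_add {r : ℕ} {G : Matrix (Fin r) (Fin r) ℝ} (hG : G.transpose = G)
    (g θ θ' : EuclideanSpace ℝ (Fin r)) :
    quadLoss G g θ = quadLoss G g θ' + 1 / 2 * ((θ - θ').ofLp ⬝ᵥ G.mulVec (θ - θ').ofLp) +
      (θ - θ').ofLp ⬝ᵥ (G.mulVec θ'.ofLp - g.ofLp) := by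
  have h : ∀ a b : Fin r → ℝ, a ⬝ᵥ G.mulVec b = b ⬝ᵥ G.mulVec a := by
    intro a b
    rw [Matrix.dotProduct_mulVec, ← Matrix.mulVec_transpose, hG, dotProduct_comm]
  simp only [quadLoss, WithLp.ofLp_sub, Matrix.mulVec_sub, sub_dotProduct, dotProduct_sub]
  rw [h θ'.ofLp θ.ofLp]
  ring

/-- Closeness of the coefficients of the loss to those of a coercive quadratic form. -/
theorem coercive_of_close {r : ℕ} {G Γ : Matrix (Fin r) (Fin r) ℝ} {lam δ : ℝ}
    (hΓ : ∀ u : EuclideanSpace ℝ (Fin r), lam * ‖u‖ ^ 2 ≤ u.ofLp ⬝ᵥ Γ.mulVec u.ofLp)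
    (hGΓ : ‖vecMatrix G - vecMatrix Γ‖ ≤ δ) (hδ : δ ≤ lam / 2) (u : EuclideanSpace ℝ (Fin r)) :
    lam / 2 * ‖u‖ ^ 2 ≤ u.ofLp ⬝ᵥ G.mulVec u.ofLp := by
  have h1 := abs_dotProduct_mulVec_le (G - Γ) u u
  rw [vecMatrix_sub, Matrix.sub_mulVec, dotProduct_sub] at h1
  have h2 := (abs_le.1 h1).1
  have h3 := hΓ u
  nlinarith [mul_le_mul_of_nonneg_right (hGΓ.trans hδ) (mul_self_nonneg ‖u‖)]

theorem posDef_of_coercive {r : ℕ} {G : Matrix (Fin r) (Fin r) ℝ} (hG : G.transpose = G) {c : ℝ}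
    (hc : 0 < c) (h : ∀ u : EuclideanSpace ℝ (Fin r), c * ‖u‖ ^ 2 ≤ u.ofLp ⬝ᵥ G.mulVec u.ofLp) :
    G.PosDef := by
  refine Matrix.PosDef.of_dotProduct_mulVec_pos (by simpa [Matrix.IsHermitian] using hG)
    fun {x} hx => ?_
  have h1 := h (WithLp.toLp 2 x)
  have h2 : 0 < ‖(WithLp.toLp 2 x : EuclideanSpace ℝ (Fin r))‖ := by
    rw [norm_pos_iff]
    simpa using hx
  have : 0 < c * ‖(WithLp.toLp 2 x : EuclideanSpace ℝ (Fin r))‖ ^ 2 := by positivity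
  simpa using this.trans_le h1

/-- Expand at θ₀, with d = θ - θ₀. The quadratic term is at least (lam/4)‖d‖². As Γ θ₀ = g₀, the
gradient there is (G - Γ)θ₀ - (g - g₀), so the linear term is at least -δ(1 + ‖θ₀‖)‖d‖. Their sum is
at most 0. -/
theorem norm_sub_le_of_quadLoss_le {r : ℕ} {G Γ : Matrix (Fin r) (Fin r) ℝ}
    (hG : G.transpose = G) {lam δ : ℝ} (hlam : 0 < lam)
    (hΓ : ∀ u : EuclideanSpace ℝ (Fin r), lam * ‖u‖ ^ 2 ≤ u.ofLp ⬝ᵥ Γ.mulVec u.ofLp)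
    (hGΓ : ‖vecMatrix G - vecMatrix Γ‖ ≤ δ) (hδ : δ ≤ lam / 2)
    {g g₀ θ₀ θ : EuclideanSpace ℝ (Fin r)} (hg : ‖g - g₀‖ ≤ δ) (hθ₀ : Γ.mulVec θ₀.ofLp = g₀.ofLp)
    (hle : quadLoss G g θ ≤ quadLoss G g θ₀) :
    ‖θ - θ₀‖ ≤ 4 * δ * (1 + ‖θ₀‖) / lam := by
  rw [quadLoss_eq_add hG g θ θ₀] at hle
  have h1 := coercive_of_close hΓ hGΓ hδ (θ - θ₀)
  have h2 : (θ - θ₀).ofLp ⬝ᵥ (G.mulVec θ₀.ofLp - g.ofLp) =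
      (θ - θ₀).ofLp ⬝ᵥ (G - Γ).mulVec θ₀.ofLp - (θ - θ₀).ofLp ⬝ᵥ (g - g₀).ofLp := by
    rw [← dotProduct_sub, Matrix.sub_mulVec, hθ₀, WithLp.ofLp_sub 2 g g₀]
    congr 1
    abel
  have h3 := abs_le.1 (abs_dotProduct_mulVec_le (G - Γ) (θ - θ₀) θ₀)
  have h4 := abs_le.1 (abs_dotProduct_le (θ - θ₀) (g - g₀))
  rw [vecMatrix_sub] at h3
  have hd := norm_nonneg (θ - θ₀)
  have h5 : ‖vecMatrix G - vecMatrix Γ‖ * (‖θ - θ₀‖ * ‖θ₀‖) ≤ δ * (‖θ - θ₀‖ * ‖θ₀‖) :=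
    mul_le_mul_of_nonneg_right hGΓ (by positivity)
  have h6 : ‖θ - θ₀‖ * ‖g - g₀‖ ≤ ‖θ - θ₀‖ * δ := mul_le_mul_of_nonneg_left hg hd
  have h7 : ‖θ - θ₀‖ * (lam * ‖θ - θ₀‖) ≤ ‖θ - θ₀‖ * (4 * δ * (1 + ‖θ₀‖)) := by
    nlinarith
  rw [le_div_iff₀ hlam, mul_comm]
  rcases hd.eq_or_lt with h0 | h0
  · rw [← h0]
    have : 0 ≤ δ := (norm_nonneg _).trans hg
    have : 0 ≤ ‖θ₀‖ := norm_nonneg _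
    rw [mul_zero]
    positivity
  · exact le_of_mul_le_mul_left h7 h0

theorem quadLoss_eq_invMul_add {r : ℕ} {G : Matrix (Fin r) (Fin r) ℝ} (hG : G.PosDef)
    (g θ : EuclideanSpace ℝ (Fin r)) :
    quadLoss G g θ = quadLoss G g (invMul G g) +
      1 / 2 * ((θ - invMul G g).ofLp ⬝ᵥ G.mulVec (θ - invMul G g).ofLp) := by
  have h : G.mulVec (invMul G g).ofLp = g.ofLp := by
    have hu : IsUnit G.det := hG.det_pos.ne'.isUnit
    simp [invMul, Matrix.mulVec_mulVec, Matrix.mul_nonsing_inv _ hu]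
  rw [quadLoss_eq_add (by simpa [Matrix.IsHermitian] using hG.isHermitian) g θ (invMul G g), h,
    sub_self, dotProduct_zero, add_zero]

theorem quadLoss_invMul_le {r : ℕ} {G : Matrix (Fin r) (Fin r) ℝ} (hG : G.PosDef)
    (g θ : EuclideanSpace ℝ (Fin r)) : quadLoss G g (invMul G g) ≤ quadLoss G g θ := by
  rw [quadLoss_eq_invMul_add hG g θ]
  have := hG.posSemidef.dotProduct_mulVec_nonneg (θ - invMul G g).ofLp
  simp only [star_trivial] at this
  linarith

theorem isLossMin_iff_eq_invMul {r : ℕ} {G : Matrix (Fin r) (Fin r) ℝ} (hG : G.PosDef)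
    {g : EuclideanSpace ℝ (Fin r)} {S : Set (EuclideanSpace ℝ (Fin r))} (hS : invMul G g ∈ S)
    (θ : EuclideanSpace ℝ (Fin r)) : IsLossMin S G g θ ↔ θ = invMul G g := by
  constructor
  · rintro ⟨-, h⟩
    have h1 := h _ hS
    rw [quadLoss_eq_invMul_add hG g θ] at h1
    by_contra hne
    have h2 := hG.dotProduct_mulVec_pos (x := (θ - invMul G g).ofLp)
      (fun h0 => hne (sub_eq_zero.1 (WithLp.ofLp_injective 2 h0)))
    simp only [star_trivial] at h2
    linarith
  · rintro rfl
    exact ⟨hS, fun θ' _ => quadLoss_invMul_le hG g θ'⟩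

/-- A positive definite quadratic form is coercive. -/
theorem exists_coercive {r : ℕ} {Γ : Matrix (Fin r) (Fin r) ℝ}
    (hΓ : ∀ u : EuclideanSpace ℝ (Fin r), u ≠ 0 → 0 < u.ofLp ⬝ᵥ Γ.mulVec u.ofLp) :
    ∃ lam > 0, ∀ u : EuclideanSpace ℝ (Fin r), lam * ‖u‖ ^ 2 ≤ u.ofLp ⬝ᵥ Γ.mulVec u.ofLp := by
  -- The unit sphere is empty exactly when r = 0; otherwise lam is the minimum of the form on this
  -- compact set.
  rcases (Metric.sphere (0 : EuclideanSpace ℝ (Fin r)) 1).eq_empty_or_nonempty with he | hne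
  · refine ⟨1, one_pos, fun u => ?_⟩
    have : u = 0 := by
      by_contra hu
      have : (‖u‖⁻¹ • u) ∈ Metric.sphere (0 : EuclideanSpace ℝ (Fin r)) 1 := by
        simp [norm_smul, hu]
      rw [he] at this
      exact this
    simp [this]
  · have hcont : Continuous fun u : EuclideanSpace ℝ (Fin r) => u.ofLp ⬝ᵥ Γ.mulVec u.ofLp := by
      simp only [dotProduct, Matrix.mulVec]
      fun_prop
    obtain ⟨u₀, hu₀, hmin⟩ := (isCompact_sphere (0 : EuclideanSpace ℝ (Fin r)) 1).exists_isMinOn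
      hne hcont.continuousOn
    refine ⟨_, hΓ u₀ (fun h => by simp [h] at hu₀), fun u => ?_⟩
    rcases eq_or_ne u 0 with rfl | hu
    · simp
    have hmem : (‖u‖⁻¹ • u) ∈ Metric.sphere (0 : EuclideanSpace ℝ (Fin r)) 1 := by
      simp [norm_smul, hu]
    have h1 := hmin hmem
    simp only [Set.mem_ofPred_eq, WithLp.ofLp_smul, Matrix.mulVec_smul, smul_dotProduct,
      dotProduct_smul, smul_eq_mul] at h1
    have h2 : 0 < ‖u‖ := norm_pos_iff.2 hu
    calc _ ≤ (‖u‖⁻¹ * (‖u‖⁻¹ * (u.ofLp ⬝ᵥ Γ.mulVec u.ofLp))) * ‖u‖ ^ 2 := by gcongr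
      _ = _ := by field_simp

/-! ### Consistency of geometric medians of means -/

/-- Agreement of `v` and `w` is needed only inside block `k`, so an uncorrupted block has the mean
of the clean sequence. -/
theorem blockMean_eq {V : Type*} [AddCommGroup V] [Module ℝ V] {n : ℕ} (K : ℕ) (v : Fin n → V)
    (w : ℕ → V) (k : Fin K) (h : ∀ i : Fin n, i.val / (n / K) = k.val → v i = w i) :
    blockMean K v k =
      ((n / K : ℕ) : ℝ)⁻¹ • ∑ i ∈ Finset.range (n / K), w (k.val * (n / K) + i) := by
  rcases (n / K).eq_zero_or_pos with h0 | hB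
  · simp [blockMean, h0]
  rw [blockMean]
  congr 1
  have h1 : (k.val + 1) * (n / K) ≤ n :=
    (Nat.mul_le_mul_right _ k.isLt).trans (Nat.mul_div_le n K)
  have h2 : (k.val + 1) * (n / K) = k.val * (n / K) + n / K := by ring
  have h3 : ∑ i ∈ Finset.range (n / K), w (k.val * (n / K) + i) =
      ∑ i ∈ Finset.Ico (k.val * (n / K)) ((k.val + 1) * (n / K)), w i := by
    rw [Finset.sum_Ico_eq_sum_range, h2, Nat.add_sub_cancel_left]
  rw [h3]
  refine Finset.sum_nbij (fun i : Fin n => i.val) ?_ ?_ ?_ ?_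
  · intro i hi
    simpa using hi
  · intro i _ j _ hij
    exact Fin.ext hij
  · intro i hi
    rw [Finset.coe_Ico, Set.mem_Ico] at hi
    exact ⟨⟨i, by omega⟩, by simpa using hi, rfl⟩
  · intro i hi
    rw [Finset.mem_filter] at hi
    exact h i ((Nat.div_eq_iff hB).2 ⟨by omega, by omega⟩)

/-- If few of the uncontaminated block means deviate and few observations are contaminated, then
the geometric median of means is accurate. -/
theorem IsGMoM.norm_sub_le {V : Type*} [NormedAddCommGroup V] [NormedSpace ℝ V] {n c K : ℕ}
    (hK : K = 4 * c + 1) {v : Fin n → V} {w : ℕ → V} {z a : V} (hz : IsGMoM K v z)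
    (hc : {i : Fin n | v i ≠ w i}.ncard ≤ c) {ε : ℝ} (D : Finset (Fin K))
    (hD : ∀ k ∉ D, ‖((n / K : ℕ) : ℝ)⁻¹ •
      ∑ i ∈ Finset.range (n / K), w (k.val * (n / K) + i) - a‖ ≤ ε)
    (hcard : 8 * D.card < K) : ‖z - a‖ ≤ 8 * ε := by
  classical
  -- The contaminated blocks. Each is the image of a corrupted index under i ↦ i / (n / K), so there
  -- are at most c of them.
  set C : Finset (Fin K) := Finset.univ.filter
    fun k => ∃ i : Fin n, i.val / (n / K) = k.val ∧ v i ≠ w i with hC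
  have hCc : C.card ≤ c := by
    rw [Set.ncard_eq_toFinset_card'] at hc
    rw [← Finset.card_image_of_injective C Fin.val_injective]
    refine le_trans (Finset.card_le_card ?_) ((Finset.card_image_le
      (f := fun i : Fin n => i.val / (n / K))).trans hc)
    intro k hk
    simp only [hC, Finset.mem_image, Finset.mem_filter, Finset.mem_univ, true_and] at hk
    obtain ⟨k', ⟨i, hi, hne⟩, rfl⟩ := hk
    exact Finset.mem_image.2 ⟨i, by simpa using hne, hi⟩
  refine IsGeometricMedian.norm_sub_le hz (D ∪ C) (fun k hk => ?_) ?_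
  · rw [Finset.mem_union, not_or] at hk
    rw [blockMean_eq K v w k fun i hi => ?_]
    · exact hD k hk.1
    · by_contra hne
      exact hk.2 (by simpa [hC] using ⟨i, hi, hne⟩)
  -- From 8|D| < K and 8|C| ≤ 8c = 2(K - 1) the union satisfies 8|D ∪ C| < 3K; this is where K = 4c
  -- + 1 enters.
  · have := Finset.card_union_le D C
    omega

section Probability

variable {V : Type*} [NormedAddCommGroup V] [NormedSpace ℝ V]
  [MeasurableSpace V] [BorelSpace V] [SecondCountableTopology V]
  {Ω : Type*} [MeasurableSpace Ω] {μ : Measure Ω} {Z : ℕ → Ω → V}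

/-- A shifted i.i.d. sequence has the same law on sequence space, so all blocks deviate with the
same probability. -/
theorem measure_blockMean_deviation (hZ : iIndepFun Z μ)
    (hident : ∀ i, IdentDistrib (Z i) (Z 0) μ μ) (a : V) (ε : ℝ) (s B : ℕ) :
    μ {ω | ε ≤ ‖(B : ℝ)⁻¹ • ∑ i ∈ Finset.range B, Z (s + i) ω - a‖} =
      μ {ω | ε ≤ ‖(B : ℝ)⁻¹ • ∑ i ∈ Finset.range B, Z i ω - a‖} := by
  have h := IdentDistrib.pi (X := fun i => Z (s + i)) (Y := Z)
    (fun i => (hident (s + i)).trans (hident i).symm)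
    (hZ.precomp (add_right_injective s)) hZ
  have hmeas : Measurable fun y : ℕ → V => ‖(B : ℝ)⁻¹ • ∑ i ∈ Finset.range B, y i - a‖ := by
    fun_prop
  exact (h.comp hmeas).measure_mem_eq measurableSet_Ici

theorem nullMeasurableSet_blockMean_deviation (hident : ∀ i, IdentDistrib (Z i) (Z 0) μ μ)
    (a : V) (ε : ℝ) (s B : ℕ) :
    NullMeasurableSet {ω | ε ≤ ‖(B : ℝ)⁻¹ • ∑ i ∈ Finset.range B, Z (s + i) ω - a‖} μ := by
  have h : ∀ i, AEMeasurable (Z i) μ := fun i => (hident i).aemeasurable_fst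
  have : AEMeasurable (fun ω => ‖(B : ℝ)⁻¹ • ∑ i ∈ Finset.range B, Z (s + i) ω - a‖) μ := by
    fun_prop
  exact this.nullMeasurableSet_preimage measurableSet_Ici

/-- Markov's inequality for the number of deviating blocks. -/
theorem measure_many_deviations_le (hZ : iIndepFun Z μ)
    (hident : ∀ i, IdentDistrib (Z i) (Z 0) μ μ) (a : V) (ε : ℝ) (K B : ℕ) (hK : 0 < K) :
    μ {ω | K ≤ 8 * (Finset.univ.filter fun k : Fin K =>
        ε ≤ ‖(B : ℝ)⁻¹ • ∑ i ∈ Finset.range B, Z (k.val * B + i) ω - a‖).card} ≤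
      8 * μ {ω | ε ≤ ‖(B : ℝ)⁻¹ • ∑ i ∈ Finset.range B, Z i ω - a‖} := by
  set q := μ {ω | ε ≤ ‖(B : ℝ)⁻¹ • ∑ i ∈ Finset.range B, Z i ω - a‖} with hq
  set A : Fin K → Set Ω := fun k =>
    {ω | ε ≤ ‖(B : ℝ)⁻¹ • ∑ i ∈ Finset.range B, Z (k.val * B + i) ω - a‖} with hA
  have hAm : ∀ k, NullMeasurableSet (A k) μ := fun k =>
    nullMeasurableSet_blockMean_deviation hident a ε _ B
  have hcount : ∀ ω, ((Finset.univ.filter fun k : Fin K =>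
        ε ≤ ‖(B : ℝ)⁻¹ • ∑ i ∈ Finset.range B, Z (k.val * B + i) ω - a‖).card : ENNReal) =
      ∑ k, (A k).indicator (fun _ => (1 : ENNReal)) ω := by
    intro ω
    rw [Finset.card_filter]
    push_cast
    refine Finset.sum_congr rfl fun k _ => ?_
    simp only [hA, Set.indicator_apply, Set.mem_ofPred_eq]
  have hint : ∫⁻ ω, ∑ k, (A k).indicator (fun _ => (1 : ENNReal)) ω ∂μ = K * q := by
    rw [lintegral_finsetSum' _ fun k _ => (aemeasurable_const.indicator₀ (hAm k))]
    have : ∀ k, ∫⁻ ω, (A k).indicator (fun _ => (1 : ENNReal)) ω ∂μ = q := fun k => by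
      rw [lintegral_indicator₀ (hAm k), setLIntegral_one]
      exact measure_blockMean_deviation hZ hident a ε _ B
    simp [this]
  -- The expected number of deviating blocks is K q, so Markov bounds K times the probability by 8 K
  -- q; the factor K cancels in the end.
  have hmarkov := mul_meas_ge_le_lintegral₀ (μ := μ)
    (f := fun ω => 8 * ∑ k, (A k).indicator (fun _ => (1 : ENNReal)) ω)
    ((Finset.aemeasurable_fun_sum _ fun k _ => aemeasurable_const.indicator₀ (hAm k)).const_mul 8)
    (K : ENNReal)
  rw [lintegral_const_mul' _ _ (by simp), hint, ← mul_assoc, mul_comm 8 (K : ENNReal),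
    mul_assoc] at hmarkov
  have hset : {ω | K ≤ 8 * (Finset.univ.filter fun k : Fin K =>
        ε ≤ ‖(B : ℝ)⁻¹ • ∑ i ∈ Finset.range B, Z (k.val * B + i) ω - a‖).card} =
      {ω | (K : ENNReal) ≤ 8 * ∑ k, (A k).indicator (fun _ => (1 : ENNReal)) ω} := by
    ext ω
    rw [Set.mem_ofPred_eq, Set.mem_ofPred_eq, ← hcount ω]
    exact_mod_cast Iff.rfl
  rw [hset]
  exact (ENNReal.mul_le_mul_iff_right (by exact_mod_cast hK.ne') (by simp)).1 hmarkov

theorem tendsto_block_size {nc : ℕ → ℕ} (hnc : (fun n => (nc n : ℝ)) =o[atTop] fun n => (n : ℝ)) :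
    Tendsto (fun n => n / (4 * nc n + 1)) atTop atTop := by
  rw [tendsto_atTop]
  intro b
  -- This makes 4 b nc ≤ n/2, and n ≥ 2(b + 1) makes b ≤ n/2; together b (4 nc + 1) ≤ n.
  have h := hnc.bound (c := 1 / (8 * (b + 1))) (by positivity)
  filter_upwards [h, eventually_ge_atTop (2 * (b + 1))] with n hn hb
  rw [Nat.le_div_iff_mul_le (by omega)]
  simp only [RCLike.norm_natCast] at hn
  rw [div_mul_eq_mul_div, one_mul, le_div_iff₀ (by positivity)] at hn
  have hn' : nc n * (8 * (b + 1)) ≤ n := by exact_mod_cast hn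
  nlinarith

/-- Geometric medians of means with `4 c + 1` blocks are consistent under contamination of up to
`c = o(n)` observations. -/
theorem tendstoInMeasure_of_isGMoM [CompleteSpace V] [IsProbabilityMeasure μ] (hZ : iIndepFun Z μ)
    (hident : ∀ i, IdentDistrib (Z i) (Z 0) μ μ) (hint : Integrable (Z 0) μ) {nc : ℕ → ℕ}
    (hnc : (fun n => (nc n : ℝ)) =o[atTop] fun n => (n : ℝ)) {W : (n : ℕ) → Fin n → Ω → V}
    (hW : ∀ n, ∀ᵐ ω ∂μ, {i : Fin n | W n i ω ≠ Z i ω}.ncard ≤ nc n) {z : ℕ → Ω → V}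
    (hz : ∀ n ω, IsGMoM (4 * nc n + 1) (fun i => W n i ω) (z n ω)) :
    TendstoInMeasure μ z atTop fun _ => ∫ ω, Z 0 ω ∂μ := by
  classical
  rw [tendstoInMeasure_iff_norm]
  intro ε hε
  set a := ∫ ω, Z 0 ω ∂μ
  have hmean : TendstoInMeasure μ (fun (B : ℕ) ω => (B : ℝ)⁻¹ • ∑ i ∈ Finset.range B, Z i ω) atTop
      fun _ => a := by
    refine tendstoInMeasure_of_tendsto_ae (fun B => ?_)
      (strong_law_ae Z hint (fun i j hij => hZ.indepFun hij) hident)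
    exact ((Finset.aestronglyMeasurable_fun_sum _ fun i _ =>
      ((hident i).aemeasurable_fst.aestronglyMeasurable)).const_smul _)
  rw [tendstoInMeasure_iff_norm] at hmean
  -- With ε/16 the factor 8 of the deterministic bound yields ε/2, strictly below ε.
  have hlim := ((hmean (ε / 16) (by positivity)).comp (tendsto_block_size hnc))
  have hlim8 := ENNReal.Tendsto.const_mul (a := 8) hlim (Or.inr (by simp))
  rw [mul_zero] at hlim8
  refine tendsto_of_tendsto_of_tendsto_of_le_of_le tendsto_const_nhds hlim8
    (fun _ => zero_le) fun n => ?_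
  refine le_trans (measure_mono_ae ?_)
    (measure_many_deviations_le hZ hident a (ε / 16) (4 * nc n + 1) (n / (4 * nc n + 1))
      (Nat.succ_pos _))
  filter_upwards [hW n] with ω hω hle
  by_contra hlt
  have := (hz n ω).norm_sub_le rfl (a := a) (w := fun i => Z i ω) (ε := ε / 16) hω _
    (fun k hk => ?_) (not_le.1 hlt)
  · have hle' : ε ≤ ‖z n ω - a‖ := hle
    linarith
  · simp only [Finset.mem_filter, Finset.mem_univ, true_and, not_le] at hk
    exact hk.le

end Probability

/-! ### Integration along coordinate lines -/

theorem setCoord_eq_add {m : ℕ} (j : Fin m) (x : EuclideanSpace ℝ (Fin m)) (s : ℝ) :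
    setCoord j x s = x + (s - x j) • EuclideanSpace.single j (1 : ℝ) := by
  ext i
  rcases eq_or_ne i j with rfl | hij
  · simp [setCoord]
  · simp [setCoord, hij]

theorem setCoord_apply {m : ℕ} (j : Fin m) (x : EuclideanSpace ℝ (Fin m)) (s : ℝ) (i : Fin m) :
    setCoord j x s i = Function.update x.ofLp j s i := rfl

theorem setCoord_add {m : ℕ} (j : Fin m) (x : EuclideanSpace ℝ (Fin m)) (s c : ℝ) :
    setCoord j x (s + c) = setCoord j x s + c • EuclideanSpace.single j (1 : ℝ) := by
  rw [setCoord_eq_add, setCoord_eq_add]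
  module

theorem setCoord_setCoord {m : ℕ} (j : Fin m) (x : EuclideanSpace ℝ (Fin m)) (s c : ℝ) :
    setCoord j (setCoord j x c) s = setCoord j x s := by
  simp [setCoord]

theorem contDiff_setCoord {m : ℕ} (j : Fin m) (x : EuclideanSpace ℝ (Fin m)) {k : WithTop ℕ∞} :
    ContDiff ℝ k (setCoord j x) := by
  have : setCoord j x = fun s => x + (s - x j) • EuclideanSpace.single j (1 : ℝ) :=
    funext (setCoord_eq_add j x)
  rw [this]
  fun_prop

/-- The partial derivative is the derivative along the coordinate line. -/
theorem pd_setCoord {m : ℕ} {F : Type*} [NormedAddCommGroup F] [NormedSpace ℝ F] (j : Fin m)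
    (f : EuclideanSpace ℝ (Fin m) → F) (x : EuclideanSpace ℝ (Fin m)) (s : ℝ) :
    pd j f (setCoord j x s) = deriv (fun c => f (setCoord j x c)) s := by
  rw [pd, lineDeriv]
  simp only [← setCoord_add]
  rw [deriv_comp_const_add (fun c => f (setCoord j x c)) s 0, add_zero]

/-- A function whose integral vanishes along almost all lines in one coordinate direction has
integral zero. -/
theorem integral_eq_zero_of_lines {m : ℕ} (j : Fin m) {F : EuclideanSpace ℝ (Fin m) → ℝ}
    (hF : Integrable F)
    (h : ∀ x, Integrable (fun s => F (setCoord j x s)) → ∫ s, F (setCoord j x s) = 0) :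
    ∫ x, F x = 0 := by
  obtain _ | n := m
  · exact j.elim0
  have he := (volume_preserving_piFinSuccAbove (fun _ : Fin (n + 1) => ℝ) j).symm
  have hL := PiLp.volume_preserving_toLp (Fin (n + 1))
  have hLe : MeasurableEmbedding (WithLp.toLp 2 : (Fin (n + 1) → ℝ) → EuclideanSpace ℝ _) :=
    (MeasurableEquiv.toLp 2 (Fin (n + 1) → ℝ)).measurableEmbedding
  rw [← hL.integral_comp hLe, ← he.integral_comp (MeasurableEquiv.measurableEmbedding _)]
  have hF' := (he.integrable_comp_emb (MeasurableEquiv.measurableEmbedding _)).2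
    ((hL.integrable_comp_emb hLe).2 hF)
  have hline : ∀ (s : ℝ) (y : Fin n → ℝ),
      (WithLp.toLp 2 ((MeasurableEquiv.piFinSuccAbove (fun _ : Fin (n + 1) => ℝ) j).symm (s, y)) :
        EuclideanSpace ℝ (Fin (n + 1))) = setCoord j (WithLp.toLp 2 (j.insertNth 0 y)) s := by
    intro s y
    ext i
    simp only [setCoord, Fin.update_insertNth]
    rfl
  -- Fubini with the j-th coordinate as inner variable; almost every slice is integrable, so the
  -- hypothesis on lines applies to it.
  erw [integral_prod_symm _ hF']
  refine integral_eq_zero_of_ae ?_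
  filter_upwards [hF'.prod_left_ae] with y hy
  simp only [Function.comp_def, hline] at hy ⊢
  exact h _ hy

theorem SampleSpace.isOpen_openAxis (D : SampleSpace) : IsOpen D.openAxis := by
  cases D
  · exact isOpen_univ
  · exact isOpen_Ioi

theorem SampleSpace.uIcc_subset (D : SampleSpace) {c d : ℝ} (hc : c ∈ D.openAxis)
    (hd : d ∈ D.openAxis) : Set.uIcc c d ⊆ D.openAxis := by
  cases D
  · exact Set.subset_univ _
  · exact (Set.ordConnected_Ioi (a := (0 : ℝ))).uIcc_subset hc hd

/-- Reduces statements on the whole axis to compact intervals, where absolute continuity is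
available. The intervals run from -(n + 1), respectively 1/(n + 1), to n + 1. -/
theorem SampleSpace.exists_exhaustion (D : SampleSpace) :
    ∃ c d : ℕ → ℝ, (∀ n, c n ∈ D.openAxis) ∧ (∀ n, d n ∈ D.openAxis) ∧ (∀ n, c n ≤ d n) ∧
      Tendsto c atTop D.lowerEnd ∧ Tendsto d atTop atTop ∧
      AECover (volume.restrict D.openAxis) atTop fun n => Set.Ioc (c n) (d n) := by
  have hd : Tendsto (fun n : ℕ => (n : ℝ) + 1) atTop atTop :=
    tendsto_natCast_atTop_atTop.atTop_add tendsto_const_nhds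
  cases D
  · have hc : Tendsto (fun n : ℕ => -((n : ℝ) + 1)) atTop atBot := tendsto_neg_atTop_atBot.comp hd
    refine ⟨_, _, fun _ => trivial, fun _ => trivial, fun n => ?_, hc, hd, ?_⟩
    · have : (0 : ℝ) ≤ n := n.cast_nonneg
      linarith
    · rw [SampleSpace.openAxis, Measure.restrict_univ]
      exact aecover_Ioc hc hd
  · have hc := tendsto_one_div_add_atTop_nhds_zero_nat (𝕜 := ℝ)
    have hpos : ∀ n : ℕ, (0 : ℝ) < 1 / ((n : ℝ) + 1) := fun n => Nat.one_div_pos_of_nat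
    refine ⟨_, _, hpos, fun n => ?_, fun n => ?_,
      tendsto_nhdsWithin_iff.2 ⟨hc, Eventually.of_forall hpos⟩, hd, ?_⟩
    · exact (Nat.cast_add_one_pos n : (0 : ℝ) < n + 1)
    · have : (1 : ℝ) ≤ (n : ℝ) + 1 := by linarith [n.cast_nonneg (α := ℝ)]
      exact ((div_le_one (by positivity)).2 this).trans this
    · exact (aecover_Ioi_of_Ioi hc).inter (aecover_Iic hd |>.mono Measure.restrict_le_self)

/-- The integral of the derivative of a locally absolutely continuous function with equal limits
at both ends is zero. -/
theorem SampleSpace.integral_deriv_eq_zero (D : SampleSpace) {f : ℝ → ℝ}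
    (hf : ∀ c ∈ D.openAxis, ∀ d ∈ D.openAxis, AbsolutelyContinuousOnInterval f c d)
    (hint : IntegrableOn (deriv f) D.openAxis) {l : ℝ} (htop : Tendsto f atTop (𝓝 l))
    (hlow : Tendsto f D.lowerEnd (𝓝 l)) : ∫ s in D.openAxis, deriv f s = 0 := by
  obtain ⟨c, d, hc, hd, hcd, hcl, hdl, hcover⟩ := D.exists_exhaustion
  have h1 := hcover.integral_tendsto_of_countably_generated hint
  have h2 : ∀ n, ∫ s in Set.Ioc (c n) (d n), deriv f s ∂(volume.restrict D.openAxis) =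
      f (d n) - f (c n) := by
    intro n
    have hsub : Set.Ioc (c n) (d n) ⊆ D.openAxis :=
      (Set.Ioc_subset_Icc_self.trans Set.Icc_subset_uIcc).trans (D.uIcc_subset (hc n) (hd n))
    rw [Measure.restrict_restrict measurableSet_Ioc, Set.inter_eq_left.2 hsub,
      ← intervalIntegral.integral_of_le (hcd n)]
    exact (hf _ (hc n) _ (hd n)).integral_deriv_eq_sub
  simp only [h2] at h1
  have h3 := (htop.comp hdl).sub (hlow.comp hcl)
  rw [sub_self] at h3
  exact tendsto_nhds_unique h1 h3

theorem SampleSpace.isOpen_openCarrier (D : SampleSpace) (m : ℕ) : IsOpen (D.openCarrier m) := by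
  have : D.openCarrier m = ⋂ j : Fin m, (fun x : EuclideanSpace ℝ (Fin m) => x j) ⁻¹' D.openAxis := by
    ext x
    simp [SampleSpace.openCarrier]
  rw [this]
  exact isOpen_iInter_of_finite fun j => D.isOpen_openAxis.preimage (by fun_prop)

theorem SampleSpace.convex_openCarrier (D : SampleSpace) (m : ℕ) : Convex ℝ (D.openCarrier m) := by
  cases D
  · intro x _ y _ a b _ _ _ j
    trivial
  · intro x hx y hy a b ha hb hab j
    exact (convex_Ioi (0 : ℝ)) (hx j) (hy j) ha hb hab

theorem SampleSpace.nonempty_openCarrier (D : SampleSpace) (m : ℕ) : (D.openCarrier m).Nonempty := by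
  refine ⟨WithLp.toLp 2 fun _ => 1, fun j => ?_⟩
  cases D
  · trivial
  · exact one_pos (α := ℝ)

theorem SampleSpace.setCoord_mem_openCarrier (D : SampleSpace) {m : ℕ} (j : Fin m)
    {x : EuclideanSpace ℝ (Fin m)} (hx : x ∈ D.openCarrier m) {s : ℝ} (hs : s ∈ D.openAxis) :
    setCoord j x s ∈ D.openCarrier m := by
  intro i
  rw [setCoord_apply]
  rcases eq_or_ne i j with rfl | hij
  · simpa using hs
  · simpa [hij] using hx i

theorem SampleSpace.openCarrier_subset (D : SampleSpace) (m : ℕ) :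
    D.openCarrier m ⊆ D.carrier m := by
  cases D
  · exact Set.subset_univ _
  · exact fun x hx j => (hx j).le

/-- The boundary of the orthant lies in finitely many coordinate hyperplanes. -/
theorem SampleSpace.openCarrier_ae_eq (D : SampleSpace) (m : ℕ) :
    D.openCarrier m =ᵐ[volume] D.carrier m := by
  refine (D.openCarrier_subset m).eventuallyLE.antisymm ?_
  rw [ae_le_set]
  cases D
  · simp [SampleSpace.openCarrier, SampleSpace.openAxis]
  have hsub : SampleSpace.nonneg.carrier m \ SampleSpace.nonneg.openCarrier m ⊆
      ⋃ j : Fin m, ((EuclideanSpace.proj j : EuclideanSpace ℝ (Fin m) →L[ℝ] ℝ).ker :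
        Set (EuclideanSpace ℝ (Fin m))) := by
    rintro x ⟨hx, hx'⟩
    simp only [SampleSpace.openCarrier, SampleSpace.openAxis, Set.mem_ofPred_eq, not_forall,
      Set.mem_Ioi, not_lt] at hx'
    obtain ⟨j, hj⟩ := hx'
    exact Set.mem_iUnion.2 ⟨j, le_antisymm hj (hx j)⟩
  refine measure_mono_null hsub (measure_iUnion_null fun j => ?_)
  refine Measure.addHaar_submodule _ _ fun h => ?_
  have : EuclideanSpace.single j (1 : ℝ) ∈
      (EuclideanSpace.proj j : EuclideanSpace ℝ (Fin m) →L[ℝ] ℝ).ker := h ▸ Submodule.mem_top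
  simp at this

/-! ### Partial derivatives of the log density -/

theorem hasLineDerivAt_pd {m : ℕ} {F : Type*} [NormedAddCommGroup F]
    [NormedSpace ℝ F] {f : EuclideanSpace ℝ (Fin m) → F} {x : EuclideanSpace ℝ (Fin m)}
    (hf : DifferentiableAt ℝ f x) (j : Fin m) :
    HasLineDerivAt ℝ f (pd j f x) x (EuclideanSpace.single j 1) :=
  LineDifferentiableAt.hasLineDerivAt (hf.hasFDerivAt.hasLineDerivAt _).lineDifferentiableAt

theorem pd_inner_sub_add {m r : ℕ} {f : EuclideanSpace ℝ (Fin m) → EuclideanSpace ℝ (Fin r)}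
    {g : EuclideanSpace ℝ (Fin m) → ℝ} {x : EuclideanSpace ℝ (Fin m)}
    (hf : DifferentiableAt ℝ f x) (hg : DifferentiableAt ℝ g x) (j : Fin m)
    (θ : EuclideanSpace ℝ (Fin r)) (c : ℝ) :
    pd j (fun y => inner ℝ θ (f y) - c + g y) x = inner ℝ θ (pd j f x) + pd j g x := by
  refine HasLineDerivAt.lineDeriv ?_
  have h1 : HasDerivAt (fun s : ℝ => f (x + s • EuclideanSpace.single j (1 : ℝ))) (pd j f x) 0 :=
    hasLineDerivAt_pd hf j
  have h2 : HasDerivAt (fun s : ℝ => g (x + s • EuclideanSpace.single j (1 : ℝ))) (pd j g x) 0 :=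
    hasLineDerivAt_pd hg j
  exact (((innerSL ℝ θ).hasFDerivAt.comp_hasDerivAt (0 : ℝ) h1).sub_const c).add h2

/-- Allows a formula for a first partial derivative, valid only on the open carrier, to be
differentiated again. -/
theorem pd_congr {m : ℕ} {F : Type*} [NormedAddCommGroup F] [NormedSpace ℝ F] (j : Fin m)
    {f g : EuclideanSpace ℝ (Fin m) → F} {x : EuclideanSpace ℝ (Fin m)} (h : f =ᶠ[𝓝 x] g) :
    pd j f x = pd j g x := by
  have hc : ContinuousAt (fun s : ℝ => x + s • EuclideanSpace.single j (1 : ℝ)) 0 := by fun_prop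
  have h' : ∀ᶠ y in 𝓝 (x + (0 : ℝ) • EuclideanSpace.single j (1 : ℝ)), f y = g y := by
    simpa using h.eventually
  exact EventuallyEq.deriv_eq (hc.eventually h')

theorem contDiffOn_pd {m : ℕ} {F : Type*} [NormedAddCommGroup F] [NormedSpace ℝ F] (j : Fin m)
    {f : EuclideanSpace ℝ (Fin m) → F} {s : Set (EuclideanSpace ℝ (Fin m))} (hs : IsOpen s)
    {k l : WithTop ℕ∞} (hf : ContDiffOn ℝ l f s) (hkl : k + 1 ≤ l) :
    ContDiffOn ℝ k (pd j f) s := by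
  have h1 : ContDiffOn ℝ k (fun x => fderiv ℝ f x (EuclideanSpace.single j 1)) s :=
    (hf.fderiv_of_isOpen hs hkl).clm_apply contDiffOn_const
  refine h1.congr fun x hx => ?_
  have hl : l ≠ 0 := by
    rintro rfl
    exact absurd (le_trans le_add_self hkl) (by simp)
  exact ((hf.differentiableOn hl x hx).differentiableAt (hs.mem_nhds hx)).lineDeriv_eq_fderiv

namespace ExpFamily

variable {m r : ℕ} {M : ExpFamily m r} {θ₀ : EuclideanSpace ℝ (Fin r)}

theorem isOpen_openX (M : ExpFamily m r) : IsOpen M.openX := M.space.isOpen_openCarrier m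

theorem ScoreMatchingRegular.differentiableAt_t (hM : M.ScoreMatchingRegular θ₀)
    {x : EuclideanSpace ℝ (Fin m)} (hx : x ∈ M.openX) : DifferentiableAt ℝ M.t x :=
  (hM.t_smooth.differentiableOn (by simp) x hx).differentiableAt (M.isOpen_openX.mem_nhds hx)

theorem ScoreMatchingRegular.differentiableAt_b (hM : M.ScoreMatchingRegular θ₀)
    {x : EuclideanSpace ℝ (Fin m)} (hx : x ∈ M.openX) : DifferentiableAt ℝ M.b x :=
  (hM.b_smooth.differentiableOn (by simp) x hx).differentiableAt (M.isOpen_openX.mem_nhds hx)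

theorem ScoreMatchingRegular.contDiffOn_pd_t (hM : M.ScoreMatchingRegular θ₀) (j : Fin m) :
    ContDiffOn ℝ 1 (pd j M.t) M.openX :=
  contDiffOn_pd j M.isOpen_openX hM.t_smooth (by norm_num)

theorem ScoreMatchingRegular.contDiffOn_pd_b (hM : M.ScoreMatchingRegular θ₀) (j : Fin m) :
    ContDiffOn ℝ 1 (pd j M.b) M.openX :=
  contDiffOn_pd j M.isOpen_openX hM.b_smooth (by norm_num)

theorem ScoreMatchingRegular.pd_logDensity (hM : M.ScoreMatchingRegular θ₀)
    (θ : EuclideanSpace ℝ (Fin r)) (j : Fin m) {x : EuclideanSpace ℝ (Fin m)} (hx : x ∈ M.openX) :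
    pd j (M.logDensity θ) x = inner ℝ θ (pd j M.t x) + pd j M.b x :=
  pd_inner_sub_add (hM.differentiableAt_t hx) (hM.differentiableAt_b hx) j θ _

theorem ScoreMatchingRegular.pd_pd_logDensity (hM : M.ScoreMatchingRegular θ₀)
    (θ : EuclideanSpace ℝ (Fin r)) (j : Fin m) {x : EuclideanSpace ℝ (Fin m)} (hx : x ∈ M.openX) :
    pd j (pd j (M.logDensity θ)) x = inner ℝ θ (pd j (pd j M.t) x) + pd j (pd j M.b) x := by
  have hn := M.isOpen_openX.mem_nhds hx
  have h := pd_inner_sub_add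
    (((hM.contDiffOn_pd_t j).differentiableOn (by simp) x hx).differentiableAt hn)
    (((hM.contDiffOn_pd_b j).differentiableOn (by simp) x hx).differentiableAt hn) j θ 0
  rw [← h]
  refine pd_congr j ?_
  filter_upwards [hn] with y hy
  rw [hM.pd_logDensity θ j hy, sub_zero]

/-! ### Integration with respect to the members of the family -/

theorem ScoreMatchingRegular.contDiffOn_density (hM : M.ScoreMatchingRegular θ₀)
    (θ : EuclideanSpace ℝ (Fin r)) : ContDiffOn ℝ 2 (M.density θ) M.openX :=
  (((contDiffOn_const.inner ℝ hM.t_smooth).sub contDiffOn_const).add hM.b_smooth).exp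

theorem law_eq (M : ExpFamily m r) (θ : EuclideanSpace ℝ (Fin r)) :
    M.law θ = (volume.restrict M.openX).withDensity fun x => ENNReal.ofReal (M.density θ x) := by
  rw [law, X, openX, Measure.restrict_congr_set (M.space.openCarrier_ae_eq m)]

theorem law_absolutelyContinuous (M : ExpFamily m r) (θ : EuclideanSpace ℝ (Fin r)) :
    M.law θ ≪ volume.restrict M.openX := by
  rw [law_eq]
  exact withDensity_absolutelyContinuous _ _

theorem ae_mem_openX (M : ExpFamily m r) (θ : EuclideanSpace ℝ (Fin r)) :
    ∀ᵐ x ∂M.law θ, x ∈ M.openX :=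
  (M.law_absolutelyContinuous θ).ae_le (ae_restrict_mem M.isOpen_openX.measurableSet)

theorem ScoreMatchingRegular.aemeasurable_density (hM : M.ScoreMatchingRegular θ₀)
    (θ : EuclideanSpace ℝ (Fin r)) :
    AEMeasurable (fun x => ENNReal.ofReal (M.density θ x)) (volume.restrict M.openX) :=
  ((hM.contDiffOn_density θ).continuousOn.aemeasurable M.isOpen_openX.measurableSet).ennreal_ofReal

theorem ScoreMatchingRegular.integrable_law_iff (hM : M.ScoreMatchingRegular θ₀)
    (θ : EuclideanSpace ℝ (Fin r)) {f : EuclideanSpace ℝ (Fin m) → ℝ} :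
    Integrable f (M.law θ) ↔ IntegrableOn (fun x => M.density θ x * f x) M.openX := by
  rw [law_eq, integrable_withDensity_iff_integrable_smul₀' (hM.aemeasurable_density θ)
    (ae_of_all _ fun _ => ENNReal.ofReal_lt_top)]
  simp only [density, ENNReal.toReal_ofReal (Real.exp_nonneg _), smul_eq_mul, IntegrableOn]

theorem ScoreMatchingRegular.integral_law (hM : M.ScoreMatchingRegular θ₀)
    (θ : EuclideanSpace ℝ (Fin r)) (f : EuclideanSpace ℝ (Fin m) → ℝ) :
    ∫ x, f x ∂M.law θ = ∫ x in M.openX, M.density θ x * f x := by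
  rw [law_eq, integral_withDensity_eq_integral_toReal_smul₀ (hM.aemeasurable_density θ)
    (ae_of_all _ fun _ => ENNReal.ofReal_lt_top)]
  simp only [density, ENNReal.toReal_ofReal (Real.exp_nonneg _), smul_eq_mul]

/-- A property that holds for differences of points of a set with interior points and that is
invariant under scaling holds for all vectors. -/
theorem forall_of_differences {E : Type*} [NormedAddCommGroup E] [NormedSpace ℝ E] {S : Set E}
    (hS : (interior S).Nonempty) {P : E → Prop} (hsmul : ∀ (c : ℝ) u, P u → P (c • u))
    (hsub : ∀ θ ∈ S, ∀ θ' ∈ S, P (θ - θ')) (u : E) : P u := by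
  obtain ⟨θ, hθ⟩ := hS
  -- For small c > 0 the point θ + c u stays in S, and u = c⁻¹((θ + c u) - θ). Applied to log
  -- densities, differences in θ cancel b, so assumptions on Ω become statements about uᵀt for every
  -- u.
  have hc : Tendsto (fun c : ℝ => θ + c • u) (𝓝[>] 0) (𝓝 θ) := by
    have : ContinuousAt (fun c : ℝ => θ + c • u) 0 := by fun_prop
    have h2 := this.tendsto
    rw [zero_smul, add_zero] at h2
    exact h2.mono_left nhdsWithin_le_nhds
  obtain ⟨c, hcS, hc0⟩ := ((hc.eventually (mem_interior_iff_mem_nhds.1 hθ)).and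
    self_mem_nhdsWithin).exists
  have h1 := hsmul c⁻¹ _ (hsub _ hcS _ (interior_subset hθ))
  rwa [add_sub_cancel_left, inv_smul_smul₀ (ne_of_gt hc0)] at h1

/-- The flux `p(x | θ₀) h_j(x) uᵀ∂_j t(x)` has equal limits at both ends of each line. -/
theorem ScoreMatchingRegular.boundary_direction (hM : M.ScoreMatchingRegular θ₀)
    (u : EuclideanSpace ℝ (Fin r)) (j : Fin m) {x : EuclideanSpace ℝ (Fin m)} (hx : x ∈ M.openX) :
    ∃ l : ℝ, Tendsto (fun s => M.density θ₀ (setCoord j x s) * M.h j (setCoord j x s) *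
        inner ℝ u (pd j M.t (setCoord j x s))) atTop (𝓝 l) ∧
      Tendsto (fun s => M.density θ₀ (setCoord j x s) * M.h j (setCoord j x s) *
        inner ℝ u (pd j M.t (setCoord j x s))) M.space.lowerEnd (𝓝 l) := by
  revert u
  refine forall_of_differences hM.full ?_ ?_
  · rintro c u ⟨l, h1, h2⟩
    refine ⟨c * l, (h1.const_mul c).congr fun s => ?_, (h2.const_mul c).congr fun s => ?_⟩ <;>
    · rw [real_inner_smul_left]
      ring
  · intro θ hθ θ' hθ'
    obtain ⟨l, h1, h2⟩ := hM.boundary θ hθ j x hx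
    obtain ⟨l', h1', h2'⟩ := hM.boundary θ' hθ' j x hx
    have hmem : ∀ s ∈ M.space.openAxis, setCoord j x s ∈ M.openX := fun s hs =>
      M.space.setCoord_mem_openCarrier j hx hs
    have heq : ∀ s ∈ M.space.openAxis,
        M.density θ₀ (setCoord j x s) * M.h j (setCoord j x s) *
          pd j (M.logDensity θ) (setCoord j x s) -
        M.density θ₀ (setCoord j x s) * M.h j (setCoord j x s) *
          pd j (M.logDensity θ') (setCoord j x s) =
        M.density θ₀ (setCoord j x s) * M.h j (setCoord j x s) *
          inner ℝ (θ - θ') (pd j M.t (setCoord j x s)) := by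
      intro s hs
      rw [hM.pd_logDensity θ j (hmem s hs), hM.pd_logDensity θ' j (hmem s hs), inner_sub_left]
      ring
    -- The formula for the score holds only in the interior, so the two functions are compared
    -- eventually at each end.
    have htop : ∀ᶠ s in atTop, s ∈ M.space.openAxis := by
      cases M.space
      · exact Eventually.of_forall fun _ => trivial
      · exact eventually_gt_atTop 0
    have hlow : ∀ᶠ s in M.space.lowerEnd, s ∈ M.space.openAxis := by
      cases M.space
      · exact Eventually.of_forall fun _ => trivial
      · exact self_mem_nhdsWithin
    exact ⟨l - l', (h1.sub h1').congr' (htop.mono heq), (h2.sub h2').congr' (hlow.mono heq)⟩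

theorem ScoreMatchingRegular.aestronglyMeasurable_direction (hM : M.ScoreMatchingRegular θ₀)
    (u : EuclideanSpace ℝ (Fin r)) (j : Fin m) :
    AEStronglyMeasurable (fun x => inner ℝ u (pd j M.t x)) (M.law θ₀) :=
  ((continuousOn_const.inner (hM.contDiffOn_pd_t j).continuousOn).aestronglyMeasurable
    M.isOpen_openX.measurableSet).mono_ac (M.law_absolutelyContinuous θ₀)

theorem ScoreMatchingRegular.aestronglyMeasurable_score (hM : M.ScoreMatchingRegular θ₀)
    (θ : EuclideanSpace ℝ (Fin r)) (j : Fin m) :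
    AEStronglyMeasurable (pd j (M.logDensity θ)) (M.law θ₀) := by
  have h1 : AEStronglyMeasurable (pd j M.b) (M.law θ₀) :=
    ((hM.contDiffOn_pd_b j).continuousOn.aestronglyMeasurable
      M.isOpen_openX.measurableSet).mono_ac (M.law_absolutelyContinuous θ₀)
  refine ((hM.aestronglyMeasurable_direction θ j).add h1).congr ?_
  filter_upwards [M.ae_mem_openX θ₀] with x hx
  rw [hM.pd_logDensity θ j hx, Pi.add_apply]

theorem ScoreMatchingRegular.ae_h_nonneg (hM : M.ScoreMatchingRegular θ₀) (j : Fin m) :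
    ∀ᵐ x ∂M.law θ₀, 0 ≤ M.h j x :=
  (M.ae_mem_openX θ₀).mono fun x hx => hM.h_nonneg j x (M.space.openCarrier_subset m hx)

/-- For differences of parameters, (p - q)² ≤ 2p² + 2q² dominates the integrand by the squared
scores. -/
theorem ScoreMatchingRegular.integrable_direction_sq (hM : M.ScoreMatchingRegular θ₀)
    (u : EuclideanSpace ℝ (Fin r)) (j : Fin m) :
    Integrable (fun x => M.h j x * (inner ℝ u (pd j M.t x)) ^ 2) (M.law θ₀) := by
  revert u
  refine forall_of_differences hM.full ?_ ?_
  · intro c u h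
    refine (h.const_mul (c ^ 2)).congr (ae_of_all _ fun x => ?_)
    simp only [real_inner_smul_left]
    ring
  · intro θ hθ θ' hθ'
    refine (((hM.score_sq θ hθ j).const_mul 2).add ((hM.score_sq θ' hθ' j).const_mul 2)).mono'
      ((hM.h_meas j).aestronglyMeasurable.mul
        ((hM.aestronglyMeasurable_direction _ j).pow 2)) ?_
    filter_upwards [M.ae_mem_openX θ₀, hM.ae_h_nonneg j] with x hx hh
    have h1 : inner ℝ (θ - θ') (pd j M.t x) =
        pd j (M.logDensity θ) x - pd j (M.logDensity θ') x := by
      rw [hM.pd_logDensity θ j hx, hM.pd_logDensity θ' j hx, inner_sub_left]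
      ring
    rw [h1, Real.norm_eq_abs, abs_of_nonneg (by positivity), Pi.add_apply]
    have := mul_nonneg hh (sq_nonneg (pd j (M.logDensity θ) x + pd j (M.logDensity θ') x))
    linarith

/-- Dominated through |pq| ≤ p² + q², with weight h_j. -/
theorem ScoreMatchingRegular.integrable_direction_mul_score (hM : M.ScoreMatchingRegular θ₀)
    (u : EuclideanSpace ℝ (Fin r)) (j : Fin m) :
    Integrable (fun x => M.h j x * inner ℝ u (pd j M.t x) * pd j (M.logDensity θ₀) x)
      (M.law θ₀) := by
  refine ((hM.integrable_direction_sq u j).add (hM.score_sq θ₀ hM.mem j)).mono'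
    (((hM.h_meas j).aestronglyMeasurable.mul (hM.aestronglyMeasurable_direction _ j)).mul
      (hM.aestronglyMeasurable_score θ₀ j)) ?_
  filter_upwards [hM.ae_h_nonneg j] with x hh
  rw [Real.norm_eq_abs, abs_le, Pi.add_apply]
  set p := (inner ℝ u (pd j M.t x) : ℝ)
  set q := pd j (M.logDensity θ₀) x
  constructor
  · nlinarith [mul_nonneg hh (sq_nonneg (p + q)), mul_nonneg hh (sq_nonneg p),
      mul_nonneg hh (sq_nonneg q)]
  · nlinarith [mul_nonneg hh (sq_nonneg (p - q)), mul_nonneg hh (sq_nonneg p),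
      mul_nonneg hh (sq_nonneg q)]

theorem ScoreMatchingRegular.integrable_direction_deriv (hM : M.ScoreMatchingRegular θ₀)
    (u : EuclideanSpace ℝ (Fin r)) (j : Fin m) :
    Integrable (fun x => pd j (M.h j) x * inner ℝ u (pd j M.t x) +
      M.h j x * inner ℝ u (pd j (pd j M.t) x)) (M.law θ₀) := by
  revert u
  refine forall_of_differences hM.full ?_ ?_
  · intro c u h
    refine (h.const_mul c).congr (ae_of_all _ fun x => ?_)
    simp only [real_inner_smul_left]
    ring
  · intro θ hθ θ' hθ'
    refine ((hM.score_deriv θ hθ j).sub (hM.score_deriv θ' hθ' j)).congr ?_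
    filter_upwards [M.ae_mem_openX θ₀] with x hx
    simp only [Pi.sub_apply, hM.pd_logDensity _ j hx, hM.pd_pd_logDensity _ j hx, inner_sub_left]
    ring

/-- The divergence term `p(x | θ₀)⁻¹ ∂_j (p(x | θ₀) h_j(x) uᵀ∂_j t(x))`. -/
def divergence (M : ExpFamily m r) (θ₀ u : EuclideanSpace ℝ (Fin r)) (j : Fin m)
    (x : EuclideanSpace ℝ (Fin m)) : ℝ :=
  M.h j x * inner ℝ u (pd j M.t x) * pd j (M.logDensity θ₀) x +
    (pd j (M.h j) x * inner ℝ u (pd j M.t x) + M.h j x * inner ℝ u (pd j (pd j M.t) x))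

theorem ScoreMatchingRegular.integrable_divergence (hM : M.ScoreMatchingRegular θ₀)
    (u : EuclideanSpace ℝ (Fin r)) (j : Fin m) :
    Integrable (M.divergence θ₀ u j) (M.law θ₀) :=
  (hM.integrable_direction_mul_score u j).add (hM.integrable_direction_deriv u j)

/-- Product rule, with ∂_j p = p ∂_j log p. -/
theorem ScoreMatchingRegular.deriv_flux (hM : M.ScoreMatchingRegular θ₀)
    (u : EuclideanSpace ℝ (Fin r)) (j : Fin m) {x : EuclideanSpace ℝ (Fin m)} (hx : x ∈ M.openX)
    {s : ℝ} (hs : s ∈ M.space.openAxis)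
    (hh : DifferentiableAt ℝ (fun c => M.h j (setCoord j x c)) s) :
    deriv (fun c => M.density θ₀ (setCoord j x c) * M.h j (setCoord j x c) *
      inner ℝ u (pd j M.t (setCoord j x c))) s =
      M.density θ₀ (setCoord j x s) * M.divergence θ₀ u j (setCoord j x s) := by
  have hmem : setCoord j x s ∈ M.openX := M.space.setCoord_mem_openCarrier j hx hs
  have hn := M.isOpen_openX.mem_nhds hmem
  have hline : DifferentiableAt ℝ (setCoord j x) s :=
    (contDiff_setCoord j x (k := 1)).differentiable (by simp) s
  have hlog : DifferentiableAt ℝ (M.logDensity θ₀) (setCoord j x s) :=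
    (((differentiableAt_const θ₀).inner ℝ (hM.differentiableAt_t hmem)).sub_const _).add
      (hM.differentiableAt_b hmem)
  have h1 : HasDerivAt (fun c => M.logDensity θ₀ (setCoord j x c))
      (pd j (M.logDensity θ₀) (setCoord j x s)) s := by
    rw [pd_setCoord]
    exact (hlog.comp s hline).hasDerivAt
  have h2 : HasDerivAt (fun c => M.h j (setCoord j x c)) (pd j (M.h j) (setCoord j x s)) s := by
    rw [pd_setCoord]
    exact hh.hasDerivAt
  have h3 : HasDerivAt (fun c => pd j M.t (setCoord j x c))
      (pd j (pd j M.t) (setCoord j x s)) s := by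
    rw [pd_setCoord j (pd j M.t)]
    exact ((((hM.contDiffOn_pd_t j).differentiableOn (by simp) _ hmem).differentiableAt hn).comp s
      hline).hasDerivAt
  have h4 := (innerSL ℝ u).hasFDerivAt.comp_hasDerivAt s h3
  have h5 := (h1.exp.mul h2).mul h4
  refine h5.deriv.trans ?_
  simp only [divergence, density, innerSL_apply_apply, Pi.mul_apply, Function.comp_apply]
  ring

theorem ScoreMatchingRegular.integral_divergence_line (hM : M.ScoreMatchingRegular θ₀)
    (u : EuclideanSpace ℝ (Fin r)) (j : Fin m) {x : EuclideanSpace ℝ (Fin m)} (hx : x ∈ M.openX)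
    (hint : IntegrableOn (fun s => M.density θ₀ (setCoord j x s) *
      M.divergence θ₀ u j (setCoord j x s)) M.space.openAxis) :
    ∫ s in M.space.openAxis, M.density θ₀ (setCoord j x s) *
      M.divergence θ₀ u j (setCoord j x s) = 0 := by
  have hmaps : Set.MapsTo (setCoord j x) M.space.openAxis M.openX := fun s hs =>
    M.space.setCoord_mem_openCarrier j hx hs
  have hax : MeasurableSet M.space.openAxis := M.space.isOpen_openAxis.measurableSet
  -- The flux is a product of a C¹ function, the absolutely continuous weight and another C¹
  -- function.
  have hac : ∀ c ∈ M.space.openAxis, ∀ d ∈ M.space.openAxis, AbsolutelyContinuousOnInterval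
      (fun c => M.density θ₀ (setCoord j x c) * M.h j (setCoord j x c) *
        inner ℝ u (pd j M.t (setCoord j x c))) c d := by
    intro c hc d hd
    have hsub := M.space.uIcc_subset hc hd
    have h1 : ContDiffOn ℝ 1 (fun c => M.density θ₀ (setCoord j x c)) M.space.openAxis :=
      ((hM.contDiffOn_density θ₀).of_le (by norm_num)).comp
        (contDiff_setCoord j x).contDiffOn hmaps
    have h2 : ContDiffOn ℝ 1 (fun c => (inner ℝ u (pd j M.t (setCoord j x c)) : ℝ))
        M.space.openAxis :=
      contDiffOn_const.inner ℝ ((hM.contDiffOn_pd_t j).comp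
        (contDiff_setCoord j x).contDiffOn hmaps)
    exact ((h1.mono hsub).absolutelyContinuousOnInterval.fun_mul (hM.h_absCont j x hx c hc d hd)).fun_mul
        (h2.mono hsub).absolutelyContinuousOnInterval
  -- The weight is differentiable almost everywhere on each of countably many compact intervals
  -- exhausting the axis; the derivative of the flux is thus known almost everywhere, which suffices
  -- under the integral.
  have hdiff : ∀ᵐ s, s ∈ M.space.openAxis →
      DifferentiableAt ℝ (fun c => M.h j (setCoord j x c)) s := by
    obtain ⟨c, d, hc, hd, hcd, -, -, hcover⟩ := M.space.exists_exhaustion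
    have h1 : ∀ᵐ s, ∀ n, s ∈ Set.uIcc (c n) (d n) →
        DifferentiableAt ℝ (fun c => M.h j (setCoord j x c)) s :=
      ae_all_iff.2 fun n => (hM.h_absCont j x hx _ (hc n) _ (hd n)).ae_differentiableAt
    filter_upwards [h1, (ae_restrict_iff' hax).1 hcover.ae_eventually_mem] with s hs1 hs2 hs
    obtain ⟨n, hn⟩ := (hs2 hs).exists
    exact hs1 n (Set.Icc_subset_uIcc (Set.Ioc_subset_Icc_self hn))
  have heq : ∀ᵐ s ∂volume.restrict M.space.openAxis,
      deriv (fun c => M.density θ₀ (setCoord j x c) * M.h j (setCoord j x c) *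
        inner ℝ u (pd j M.t (setCoord j x c))) s =
      M.density θ₀ (setCoord j x s) * M.divergence θ₀ u j (setCoord j x s) := by
    rw [ae_restrict_iff' hax]
    filter_upwards [hdiff] with s hs hsa
    exact hM.deriv_flux u j hx hsa (hs hsa)
  obtain ⟨l, hl1, hl2⟩ := hM.boundary_direction u j hx
  rw [← integral_congr_ae heq]
  exact M.space.integral_deriv_eq_zero hac
    (Integrable.congr hint (heq.mono fun _ h => h.symm)) hl1 hl2

/-- Integration by parts: the divergence has mean zero under the true distribution. -/
theorem ScoreMatchingRegular.integral_divergence (hM : M.ScoreMatchingRegular θ₀)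
    (u : EuclideanSpace ℝ (Fin r)) (j : Fin m) :
    ∫ x, M.divergence θ₀ u j x ∂M.law θ₀ = 0 := by
  have hX := M.isOpen_openX.measurableSet
  have hax : MeasurableSet M.space.openAxis := M.space.isOpen_openAxis.measurableSet
  rw [hM.integral_law, ← integral_indicator hX]
  refine integral_eq_zero_of_lines j
    ((integrable_indicator_iff hX).2 ((hM.integrable_law_iff θ₀).1 (hM.integrable_divergence u j)))
    fun x hint => ?_
  -- The j-th coordinate of x is irrelevant to its line, so it is replaced by s₀. Either the line
  -- then meets the interior in exactly the open axis, or it misses the interior entirely.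
  obtain ⟨s₀, hs₀⟩ : M.space.openAxis.Nonempty := by
    cases M.space
    · exact ⟨0, trivial⟩
    · exact ⟨1, one_pos (α := ℝ)⟩
  by_cases hx : setCoord j x s₀ ∈ M.openX
  · have hline : ∀ s, M.openX.indicator
        (fun y => M.density θ₀ y * M.divergence θ₀ u j y) (setCoord j x s) =
        M.space.openAxis.indicator (fun s => M.density θ₀ (setCoord j (setCoord j x s₀) s) *
          M.divergence θ₀ u j (setCoord j (setCoord j x s₀) s)) s := by
      intro s
      simp only [setCoord_setCoord]
      by_cases hs : s ∈ M.space.openAxis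
      · have : setCoord j (setCoord j x s₀) s ∈ M.openX :=
          M.space.setCoord_mem_openCarrier j hx hs
        rw [setCoord_setCoord] at this
        rw [Set.indicator_of_mem hs, Set.indicator_of_mem this]
      · rw [Set.indicator_of_notMem hs, Set.indicator_of_notMem]
        intro hmem
        have := hmem j
        rw [setCoord_apply, Function.update_self] at this
        exact hs this
    simp only [hline] at hint ⊢
    rw [integral_indicator hax]
    exact hM.integral_divergence_line u j hx ((integrable_indicator_iff hax).1 hint)
  · have hline : ∀ s, setCoord j x s ∉ M.openX := by
      intro s hs
      have := M.space.setCoord_mem_openCarrier j hs hs₀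
      rw [setCoord_setCoord] at this
      exact hx this
    simp [Set.indicator_of_notMem (hline _)]

/-! ### Identification of the true parameter -/

theorem dotProduct_Gam_mulVec (M : ExpFamily m r) (u w : EuclideanSpace ℝ (Fin r))
    (x : EuclideanSpace ℝ (Fin m)) :
    u.ofLp ⬝ᵥ (M.Gam x).mulVec w.ofLp =
      ∑ j, M.h j x * inner ℝ u (pd j M.t x) * inner ℝ w (pd j M.t x) := by
  rw [Gam, Matrix.sum_mulVec, dotProduct_sum]
  refine Finset.sum_congr rfl fun j _ => ?_
  have h : ∀ a : EuclideanSpace ℝ (Fin r), inner ℝ a (pd j M.t x) =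
      (pd j M.t x).ofLp ⬝ᵥ a.ofLp := fun a => by
    simp [PiLp.inner_apply, dotProduct]
  rw [Matrix.smul_mulVec, Matrix.vecMulVec_mulVec, dotProduct_smul, dotProduct_smul, h, h,
    dotProduct_comm u.ofLp]
  simp only [smul_eq_mul, MulOpposite.smul_eq_mul_unop, MulOpposite.unop_op]
  ring

/-- Inserting ∂_j log p(·|θ₀) = θ₀ᵀ∂_j t + ∂_j b into the divergence regroups its terms into Γ θ₀
and g. -/
theorem ScoreMatchingRegular.dotProduct_Gam_sub_inner_gvec (hM : M.ScoreMatchingRegular θ₀)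
    (u : EuclideanSpace ℝ (Fin r)) {x : EuclideanSpace ℝ (Fin m)} (hx : x ∈ M.openX) :
    u.ofLp ⬝ᵥ (M.Gam x).mulVec θ₀.ofLp - inner ℝ u (M.gvec x) =
      ∑ j, M.divergence θ₀ u j x := by
  rw [dotProduct_Gam_mulVec, gvec, inner_neg_right, inner_sum, sub_neg_eq_add,
    ← Finset.sum_add_distrib]
  refine Finset.sum_congr rfl fun j _ => ?_
  rw [divergence, hM.pd_logDensity θ₀ j hx]
  simp only [inner_add_right, real_inner_smul_right]
  ring

/-- The mean of `Γ` under `P_θ₀`. -/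
def meanGam (M : ExpFamily m r) (θ₀ : EuclideanSpace ℝ (Fin r)) : Matrix (Fin r) (Fin r) ℝ :=
  Matrix.of fun i k => (∫ x, vecMatrix (M.Gam x) ∂M.law θ₀) (i, k)

theorem vecMatrix_meanGam (M : ExpFamily m r) (θ₀ : EuclideanSpace ℝ (Fin r)) :
    vecMatrix (M.meanGam θ₀) = ∫ x, vecMatrix (M.Gam x) ∂M.law θ₀ := rfl

theorem integrable_dotProduct_Gam (h : Integrable (fun x => vecMatrix (M.Gam x)) (M.law θ₀))
    (u w : EuclideanSpace ℝ (Fin r)) :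
    Integrable (fun x => u.ofLp ⬝ᵥ (M.Gam x).mulVec w.ofLp) (M.law θ₀) := by
  simp only [dotProduct_mulVec_eq_inner]
  exact h.const_inner _

theorem dotProduct_meanGam_mulVec (h : Integrable (fun x => vecMatrix (M.Gam x)) (M.law θ₀))
    (u w : EuclideanSpace ℝ (Fin r)) :
    u.ofLp ⬝ᵥ (M.meanGam θ₀).mulVec w.ofLp =
      ∫ x, u.ofLp ⬝ᵥ (M.Gam x).mulVec w.ofLp ∂M.law θ₀ := by
  simp only [dotProduct_mulVec_eq_inner, vecMatrix_meanGam]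
  exact (integral_inner h _).symm

/-- The score matching equation `E[Γ] θ₀ = E[g]`. -/
theorem ScoreMatchingRegular.meanGam_mulVec (hM : M.ScoreMatchingRegular θ₀)
    (hΓ : Integrable (fun x => vecMatrix (M.Gam x)) (M.law θ₀))
    (hg : Integrable M.gvec (M.law θ₀)) :
    (M.meanGam θ₀).mulVec θ₀.ofLp = (∫ x, M.gvec x ∂M.law θ₀).ofLp := by
  have key : ∀ u : EuclideanSpace ℝ (Fin r),
      u.ofLp ⬝ᵥ (M.meanGam θ₀).mulVec θ₀.ofLp = inner ℝ u (∫ x, M.gvec x ∂M.law θ₀) := by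
    intro u
    rw [← sub_eq_zero, dotProduct_meanGam_mulVec hΓ, ← integral_inner hg,
      ← integral_sub (integrable_dotProduct_Gam hΓ u θ₀) (hg.const_inner u),
      integral_congr_ae ((M.ae_mem_openX θ₀).mono fun x hx =>
        hM.dotProduct_Gam_sub_inner_gvec u hx),
      integral_finsetSum _ fun j _ => hM.integrable_divergence u j]
    exact Finset.sum_eq_zero fun j _ => hM.integral_divergence u j
  ext i
  simpa [EuclideanSpace.inner_single_left] using key (EuclideanSpace.single i 1)

/-- If all partial derivatives of `t_i` vanish, then `t_i` is constant. -/
theorem ScoreMatchingRegular.exists_mem_R (hM : M.ScoreMatchingRegular θ₀)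
    (hA1 : M.NonconstantStatistic) (i : Fin r) : ∃ j, i ∈ M.R j := by
  by_contra! h
  obtain ⟨x, hx, y, hy, hne⟩ := hA1 i
  have hd : ∀ z ∈ M.openX, HasFDerivAt (fun z => M.t z i)
      ((EuclideanSpace.proj i : EuclideanSpace ℝ (Fin r) →L[ℝ] ℝ).comp (fderiv ℝ M.t z)) z :=
    fun z hz => (EuclideanSpace.proj i : EuclideanSpace ℝ (Fin r) →L[ℝ] ℝ).hasFDerivAt.comp z
      (hM.differentiableAt_t hz).hasFDerivAt
  have h0 : ∀ z ∈ M.openX,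
      (EuclideanSpace.proj i : EuclideanSpace ℝ (Fin r) →L[ℝ] ℝ).comp (fderiv ℝ M.t z) = 0 := by
    intro z hz
    have hpd : ∀ j, fderiv ℝ M.t z (EuclideanSpace.single j 1) i = 0 := by
      intro j
      by_contra hne
      refine h j ⟨z, hz, ?_⟩
      rwa [pd, (hM.differentiableAt_t hz).lineDeriv_eq_fderiv]
    refine ContinuousLinearMap.coe_injective
      ((EuclideanSpace.basisFun (Fin m) ℝ).toBasis.ext fun j => ?_)
    simpa using hpd j
  refine hne (Convex.is_const_of_fderivWithin_eq_zero (𝕜 := ℝ) (f := fun z => M.t z i)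
    (M.space.convex_openCarrier m) (fun z hz => (hd z hz).differentiableAt.differentiableWithinAt)
    (fun z hz => ?_) hx hy)
  rw [fderivWithin_of_isOpen (M.space.isOpen_openCarrier m) hz, (hd z hz).fderiv, h0 z hz]

/-- The matrix `E[Γ]` is positive definite. -/
theorem ScoreMatchingRegular.meanGam_pos (hM : M.ScoreMatchingRegular θ₀)
    (hA1 : M.NonconstantStatistic) (hA2 : M.NullPreimages)
    (hΓ : Integrable (fun x => vecMatrix (M.Gam x)) (M.law θ₀))
    (u : EuclideanSpace ℝ (Fin r)) (hu : u ≠ 0) :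
    0 < u.ofLp ⬝ᵥ (M.meanGam θ₀).mulVec u.ofLp := by
  classical
  have hX := M.isOpen_openX.measurableSet
  have hnn : ∀ x ∈ M.openX, ∀ j, 0 ≤ M.h j x * inner ℝ u (pd j M.t x) * inner ℝ u (pd j M.t x) :=
    fun x hx j => by
      rw [mul_assoc]
      exact mul_nonneg (hM.h_nonneg j x (M.space.openCarrier_subset m hx)) (mul_self_nonneg _)
  have hint := (hM.integrable_law_iff θ₀).1 (integrable_dotProduct_Gam hΓ u u)
  rw [dotProduct_meanGam_mulVec hΓ, hM.integral_law]
  have h0 : 0 ≤ᵐ[volume.restrict M.openX]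
      fun x => M.density θ₀ x * (u.ofLp ⬝ᵥ (M.Gam x).mulVec u.ofLp) := by
    filter_upwards [ae_restrict_mem hX] with x hx
    rw [dotProduct_Gam_mulVec]
    exact mul_nonneg (Real.exp_nonneg _) (Finset.sum_nonneg fun j _ => hnn x hx j)
  refine (integral_nonneg_of_ae h0).lt_of_ne' fun hzero => ?_
  rw [integral_eq_zero_iff_of_nonneg_ae h0 hint] at hzero
  obtain ⟨i, hi⟩ : ∃ i, u i ≠ 0 := by
    by_contra! h
    exact hu (by ext i; simpa using h i)
  obtain ⟨j, hj⟩ := hM.exists_mem_R hA1 i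
  -- Pairing with u restricted to R_j. Since i ∈ R_j and u_i ≠ 0, its kernel is a proper subspace,
  -- so (A2) makes the preimage null. Vanishing of uᵀE[Γ]u would put almost all of the interior into
  -- this preimage.
  set ℓ : (M.R j → ℝ) →ₗ[ℝ] ℝ := ∑ k : M.R j, u k.1 • LinearMap.proj k with hℓ
  have hℓ_apply : ∀ w, ℓ w = ∑ k : M.R j, u k.1 * w k := fun w => by
    simp [hℓ, LinearMap.sum_apply]
  have hℓ_top : LinearMap.ker ℓ ≠ ⊤ := by
    intro h
    have h1 : Pi.single (⟨i, hj⟩ : M.R j) (1 : ℝ) ∈ LinearMap.ker ℓ := h ▸ Submodule.mem_top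
    rw [LinearMap.mem_ker, hℓ_apply, Finset.sum_eq_single ⟨i, hj⟩] at h1
    · exact hi (by simpa using h1)
    · intro k _ hk
      simp [hk]
    · simp
  have hnull := hA2 j _ hℓ_top
  have hall : ∀ᵐ x ∂volume.restrict M.openX, x ∈ {x ∈ M.X | M.v j x ∈ LinearMap.ker ℓ} := by
    filter_upwards [ae_restrict_mem hX, hzero] with x hx hx0
    have hxX := M.space.openCarrier_subset m hx
    refine ⟨hxX, ?_⟩
    have h1 : u.ofLp ⬝ᵥ (M.Gam x).mulVec u.ofLp = 0 :=
      (mul_eq_zero.1 hx0).resolve_left (Real.exp_pos _).ne'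
    rw [dotProduct_Gam_mulVec, Finset.sum_eq_zero_iff_of_nonneg fun j _ => hnn x hx j] at h1
    have h2 := h1 j (Finset.mem_univ j)
    have h3 : inner ℝ u (pd j M.t x) = ∑ k : M.R j, u k.1 * pd j M.t x k.1 := by
      have h4 : ∀ k, k ∉ M.R j → pd j M.t x k = 0 := fun k hk => by
        by_contra hne
        exact hk ⟨x, hx, hne⟩
      rw [← Finset.sum_subtype (Finset.univ.filter (· ∈ M.R j)) (by simp)
        fun k => u k * pd j M.t x k, Finset.sum_filter_of_ne]
      · simp [PiLp.inner_apply, mul_comm]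
      · intro k _ hk
        by_contra hkR
        exact hk (by rw [h4 k hkR, mul_zero])
    rw [LinearMap.mem_ker, hℓ_apply]
    have h5 : ∑ k : M.R j, u k.1 * M.v j x k =
        Real.sqrt (M.h j x) * inner ℝ u (pd j M.t x) := by
      rw [h3, Finset.mul_sum]
      exact Finset.sum_congr rfl fun k _ => by rw [v]; ring
    -- The square of √h_j uᵀ∂_j t is the j-th summand of uᵀΓu, which is zero.
    rw [h5, ← mul_self_eq_zero, mul_mul_mul_comm, Real.mul_self_sqrt (hM.h_nonneg j x hxX),
      ← mul_assoc]
    exact h2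
  have hpos : 0 < volume M.openX :=
    M.isOpen_openX.measure_pos volume (M.space.nonempty_openCarrier m)
  have hle : volume M.openX ≤ 0 := by
    rw [← hnull]
    rw [ae_restrict_iff' hX] at hall
    exact measure_mono_ae hall
  exact absurd hpos (not_lt.2 hle)

end ExpFamily

/-- Consistency of geometric medians of means of a function of the observations. -/
theorem tendstoInMeasure_of_isGMoM_comp {V : Type*} [NormedAddCommGroup V] [NormedSpace ℝ V]
    [CompleteSpace V] [MeasurableSpace V] [BorelSpace V] [SecondCountableTopology V]
    {𝓧 : Type*} [MeasurableSpace 𝓧] {P : Measure 𝓧} {f : 𝓧 → V} (hf : Integrable f P)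
    {Ω : Type*} [MeasurableSpace Ω] {μ : Measure Ω} [IsProbabilityMeasure μ] {X : ℕ → Ω → 𝓧}
    (hX : iIndepFun X μ) (hlaw : ∀ i, HasLaw (X i) P μ) {nc : ℕ → ℕ}
    (hnc : (fun n => (nc n : ℝ)) =o[atTop] fun n => (n : ℝ)) {Y : (n : ℕ) → Fin n → Ω → 𝓧}
    (hY : ∀ n, ∀ᵐ ω ∂μ, {i : Fin n | Y n i ω ≠ X i ω}.ncard ≤ nc n) {z : ℕ → Ω → V}
    (hz : ∀ n ω, IsGMoM (4 * nc n + 1) (fun i => f (Y n i ω)) (z n ω)) :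
    TendstoInMeasure μ z atTop fun _ => ∫ x, f x ∂P := by
  have hfX : ∀ i, AEMeasurable f (μ.map (X i)) := fun i => by
    rw [(hlaw i).map_eq]
    exact hf.aestronglyMeasurable.aemeasurable
  have hident : ∀ i, IdentDistrib (X i) (X 0) μ μ := fun i =>
    ⟨(hlaw i).aemeasurable, (hlaw 0).aemeasurable, (hlaw i).map_eq.trans (hlaw 0).map_eq.symm⟩
  have hmean : ∫ x, f x ∂P = ∫ ω, (f ∘ X 0) ω ∂μ := by
    rw [← (hlaw 0).map_eq, integral_map (hlaw 0).aemeasurable (hfX 0).aestronglyMeasurable]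
    rfl
  rw [hmean]
  refine tendstoInMeasure_of_isGMoM (Z := fun i => f ∘ X i)
    (hX.comp₀ (fun _ => f) (fun i => (hlaw i).aemeasurable) hfX)
    (fun i => (hident i).comp_of_aemeasurable (hfX i)) ?_ hnc
    (W := fun n i ω => f (Y n i ω)) (fun n => ?_) hz
  · rw [← (hlaw 0).map_eq] at hf
    exact hf.comp_aemeasurable (hlaw 0).aemeasurable
  · filter_upwards [hY n] with ω hω
    refine (Set.ncard_le_ncard (fun i hi => ?_) (Set.toFinite _)).trans hω
    intro h
    exact hi (congrArg f h)

end RobustSM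

end

/-- The number of blocks `K c` is a function of the number `c` of corrupted samples alone. For each
sample size `n`, `Y n` is the corrupted sample, which may differ arbitrarily from the i.i.d. sample
`X 0, …, X (n - 1)` in up to `nc n` observations; `Gh n` and `gh n` are any versions of the
geometric medians of means of `Γ` and `g` over the corrupted sample. -/
theorem corollary3p2 :
    ∃ K : ℕ → ℕ, ∀ (m r : ℕ) (M : RobustSM.ExpFamily m r) (θ₀ : EuclideanSpace ℝ (Fin r)),
      M.ScoreMatchingRegular θ₀ → M.NonconstantStatistic → M.NullPreimages →
      M.SecondMoments θ₀ →
      ∀ (Ω : Type*) [MeasurableSpace Ω] (μ : Measure Ω) [IsProbabilityMeasure μ]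
        (X : ℕ → Ω → EuclideanSpace ℝ (Fin m)),
        iIndepFun X μ → (∀ i, HasLaw (X i) (M.law θ₀) μ) →
      ∀ nc : ℕ → ℕ, (fun n => (nc n : ℝ)) =o[atTop] (fun n => (n : ℝ)) →
      ∀ Y : (n : ℕ) → Fin n → Ω → EuclideanSpace ℝ (Fin m),
        (∀ n, ∀ᵐ ω ∂μ, {i : Fin n | Y n i ω ≠ X i ω}.ncard ≤ nc n) →
      ∀ (Gh : ℕ → Ω → Matrix (Fin r) (Fin r) ℝ) (gh : ℕ → Ω → EuclideanSpace ℝ (Fin r)),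
        (∀ n ω, RobustSM.IsGMoM (K (nc n)) (fun i => RobustSM.vecMatrix (M.Gam (Y n i ω)))
          (RobustSM.vecMatrix (Gh n ω))) →
        (∀ n ω, RobustSM.IsGMoM (K (nc n)) (fun i => M.gvec (Y n i ω)) (gh n ω)) →
        -- the number of blocks is eventually admissible
        (∀ᶠ n in atTop, 1 ≤ K (nc n) ∧ K (nc n) ≤ n) ∧
        -- the matrix is positive definite with probability tending to one
        Tendsto (fun n => μ {ω | ¬ (Gh n ω).PosDef}) atTop (𝓝 0) ∧
        -- the estimator given by the inversion formula is consistent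
        TendstoInMeasure μ (fun n ω => RobustSM.invMul (Gh n ω) (gh n ω)) atTop (fun _ => θ₀) ∧
        -- all minimisers of the robust loss over the natural parameter space are consistent
        (∀ ε : ℝ, 0 < ε → Tendsto (fun n => μ {ω | ∃ θ,
          RobustSM.IsLossMin M.naturalSpace (Gh n ω) (gh n ω) θ ∧ ε ≤ dist θ θ₀})
          atTop (𝓝 0)) ∧
        -- if the true parameter is interior, then with probability tending to one the minimiser
        -- exists, is unique and is given by the inversion formula
        (θ₀ ∈ interior M.naturalSpace → Tendsto (fun n => μ {ω | ¬ ∀ θ,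
          RobustSM.IsLossMin M.naturalSpace (Gh n ω) (gh n ω) θ ↔
            θ = RobustSM.invMul (Gh n ω) (gh n ω)}) atTop (𝓝 0)) := by
  -- Fewer than a quarter of the blocks can then be contaminated, and K is positive even for c = 0.
  refine ⟨fun c => 4 * c + 1, ?_⟩
  intro m r M θ₀ hM hA1 hA2 hmom Ω _ μ _ X hX hlaw nc hnc Y hY Gh gh hGh hgh
  -- As the law of `X 0`; finiteness of the measure turns second moments into integrability.
  have hlaw_prob : IsProbabilityMeasure (M.law θ₀) :=
    (hlaw 0).isProbabilityMeasure_iff.1 inferInstance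
  have hΓ := hmom.1.integrable one_le_two
  have hg := hmom.2.integrable one_le_two
  have hsym : ∀ n ω, (Gh n ω).transpose = Gh n ω := fun n ω =>
    RobustSM.IsGMoM.transpose_eq (Nat.succ_pos _) (fun i => RobustSM.Gam_transpose M _) (hGh n ω)
  obtain ⟨lam, hlam, hcoer⟩ := RobustSM.exists_coercive (hM.meanGam_pos hA1 hA2 hΓ)
  have heq := hM.meanGam_mulVec hΓ hg
  have hG_lim := RobustSM.tendstoInMeasure_of_isGMoM_comp hΓ hX hlaw hnc hY hGh
  have hg_lim := RobustSM.tendstoInMeasure_of_isGMoM_comp hg hX hlaw hnc hY hgh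
  rw [tendstoInMeasure_iff_norm] at hG_lim hg_lim
  set g₀ := ∫ x, M.gvec x ∂M.law θ₀
  rw [← RobustSM.ExpFamily.vecMatrix_meanGam] at hG_lim
  -- an event that only occurs if one of the two medians is inaccurate has vanishing probability
  have hvanish : ∀ δ > 0, ∀ S : ℕ → Set Ω,
      (∀ n, ∀ ω ∈ S n, ‖RobustSM.vecMatrix (Gh n ω) - RobustSM.vecMatrix (M.meanGam θ₀)‖ ≤ δ →
        ‖gh n ω - g₀‖ ≤ δ → False) → Tendsto (fun n => μ (S n)) atTop (𝓝 0) := by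
    intro δ hδ S hS
    have hlim := (hG_lim δ hδ).add (hg_lim δ hδ)
    rw [add_zero] at hlim
    refine tendsto_of_tendsto_of_tendsto_of_le_of_le tendsto_const_nhds hlim
      (fun _ => zero_le) fun n => (measure_mono fun ω hω => ?_).trans (measure_union_le _ _)
    by_contra hnot
    rw [Set.mem_union, not_or] at hnot
    exact hS n ω hω (not_le.1 hnot.1).le (not_le.1 hnot.2).le
  have hposDef : ∀ n ω, ‖RobustSM.vecMatrix (Gh n ω) - RobustSM.vecMatrix (M.meanGam θ₀)‖ ≤
      lam / 2 → (Gh n ω).PosDef := fun n ω h =>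
    RobustSM.posDef_of_coercive (hsym n ω) (half_pos hlam)
      (RobustSM.coercive_of_close hcoer h le_rfl)
  have hclose : ∀ ε > 0, ∃ δ > 0, δ ≤ lam / 2 ∧ ∀ n ω θ,
      ‖RobustSM.vecMatrix (Gh n ω) - RobustSM.vecMatrix (M.meanGam θ₀)‖ ≤ δ →
      ‖gh n ω - g₀‖ ≤ δ →
      RobustSM.quadLoss (Gh n ω) (gh n ω) θ ≤ RobustSM.quadLoss (Gh n ω) (gh n ω) θ₀ →
      ‖θ - θ₀‖ < ε := by
    intro ε hε
    have h1 : 0 < 1 + ‖θ₀‖ := by positivity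
    -- The second entry makes the bound 4δ(1 + ‖θ₀‖)/lam at most ε/2; the first keeps the perturbed
    -- form coercive.
    refine ⟨min (lam / 2) (ε * lam / (8 * (1 + ‖θ₀‖))), by positivity, min_le_left _ _, ?_⟩
    intro n ω θ hGn hgn hle
    refine (RobustSM.norm_sub_le_of_quadLoss_le (hsym n ω) hlam hcoer hGn (min_le_left _ _) hgn
      heq hle).trans_lt ?_
    have h2 : min (lam / 2) (ε * lam / (8 * (1 + ‖θ₀‖))) * (8 * (1 + ‖θ₀‖)) ≤ ε * lam :=
      (le_div_iff₀ (by positivity)).1 (min_le_right _ _)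
    rw [div_lt_iff₀ hlam]
    have : 0 < ε * lam := by positivity
    linarith
  have hinv : ∀ ε > 0, ∃ δ > 0, δ ≤ lam / 2 ∧ ∀ n ω,
      ‖RobustSM.vecMatrix (Gh n ω) - RobustSM.vecMatrix (M.meanGam θ₀)‖ ≤ δ →
      ‖gh n ω - g₀‖ ≤ δ → ‖RobustSM.invMul (Gh n ω) (gh n ω) - θ₀‖ < ε := by
    intro ε hε
    obtain ⟨δ, hδ, hδl, h⟩ := hclose ε hε
    exact ⟨δ, hδ, hδl, fun n ω hGn hgn => h n ω _ hGn hgn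
      (RobustSM.quadLoss_invMul_le (hposDef n ω (hGn.trans hδl)) _ _)⟩
  refine ⟨?_, ?_, ?_, ?_, ?_⟩
  · filter_upwards [(RobustSM.tendsto_block_size hnc).eventually_ge_atTop 1] with n hn
    refine ⟨Nat.succ_pos _, ?_⟩
    simpa using (Nat.le_div_iff_mul_le (Nat.succ_pos _)).1 hn
  · exact hvanish (lam / 2) (half_pos hlam) _ fun n ω hω hGn _ => hω (hposDef n ω hGn)
  · rw [tendstoInMeasure_iff_norm]
    intro ε hε
    obtain ⟨δ, hδ, -, h⟩ := hinv ε hε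
    exact hvanish δ hδ _ fun n ω hω hGn hgn => absurd (h n ω hGn hgn) (not_lt.2 hω)
  · intro ε hε
    obtain ⟨δ, hδ, -, h⟩ := hclose ε hε
    refine hvanish δ hδ _ ?_
    rintro n ω ⟨θ, hθ, hdist⟩ hGn hgn
    rw [dist_eq_norm] at hdist
    -- θ₀ belongs to Ω, so a constrained minimizer has loss at most that of θ₀; no convexity or
    -- closedness of Ω is needed.
    exact absurd (h n ω θ hGn hgn (hθ.2 θ₀ hM.mem)) (not_lt.2 hdist)
  · intro hint
    -- Once the unconstrained minimizer enters a ball around θ₀ inside Ω it is feasible, hence the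
    -- only constrained minimizer.
    obtain ⟨ε, hε, hball⟩ := Metric.mem_nhds_iff.1 (mem_interior_iff_mem_nhds.1 hint)
    obtain ⟨δ, hδ, hδl, h⟩ := hinv ε hε
    refine hvanish δ hδ _ fun n ω hω hGn hgn => hω ?_
    refine RobustSM.isLossMin_iff_eq_invMul (hposDef n ω (hGn.trans hδl)) (hball ?_)
    rw [mem_ball_iff_norm]
    exact h n ω hGn hgn
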